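/- Fix a finite set $AP$ of atomic propositions. A tree is a rooted, unordered tree in which every node has finitely many and at least one immediate successors, and whose nodes are labelled by subsets of $AP$. PastCTL$^*$ has state formulae $\varphi ::= p \mid \neg\varphi \mid \varphi\lor\varphi \mid D^n\varphi \mid E\psi$ and path formulae $\psi ::= \varphi \mid \neg\psi \mid \psi\lor\psi \mid X\psi \mid Y\psi \mid \psi\,U\,\psi \mid \psi\,R\,\psi \mid \psi\,S\,\psi$ ($p\in AP$, $n\in\mathbb N$). State formulae are evaluated at a node $u$ of a tree, path formulae at a position of an infinite path: $D^n\varphi$ says that at least $n$ distinct successors of $u$ satisfy $\varphi$; $E\psi$ says that some infinite path that starts at the root and visits $u$, at position $i$ say, satisfies $\psi$ at position $i$; $X,U,R$ (next, until, release) and $Y,S$ (yesterday, since) have their usual meaning on the path. Write $A\psi=\neg E\neg\psi$, $\top = p\lor\neg p$, $F\psi=\top\,U\,\psi$. CTL$^*$ is the fragment without $Y,S$; PastCTL is the fragment in which every occurrence of $X,U,R$ is immediately preceded by $E$; CTL is the intersection of these two fragments. PastCTL$_\pm$ is the fragment given by $\varphi ::= p \mid \neg\varphi\mid\varphi\lor\varphi\mid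 D^n\varphi\mid E X\varphi\mid E(\varphi\,U\,\varphi)\mid E Y\varphi\mid E(\varphi\,S\,\varphi)$, and CTL$_\pm$ is its fragment without $Y,S$. Two state formulae are initially equivalent if they hold at the roots of the same trees. A state formula is expressible in a logic if it is initially equivalent to some formula of that logic; it is FO-expressible if some first-order sentence over the ancestor relation, equality and the unary predicates $p\in AP$ holds in exactly the trees at whose root the formula holds. A logic $L$ is strictly less expressive than $L'$ if there is an effective translation of each formula of $L$ into an initially equivalent formula of $L'$, while some formula of $L'$ is not expressible in $L$. Two logics are incomparable if each has a formula that is not expressible in the other. Theorem. As sets of formulae, CTL$_\pm\subseteq$ PastCTL$_\pm\subseteq$ PastCTL. Moreover: (1) If $AP$ has at least four elements, CTL$_\pm$ is strictly less expressive than PastCTL$_\pm$. (2) If $AP$ has at least four elements, PastCTL$_\pm$ and CTL are incomparable. (3) If $AP$ is nonempty, PastCTL$_\pm$ is strictly less expressive than PastCTL. Witnesses: for pairwise distinct $s,a,b,r\in AP$, the formula $E((s\lor(a\,U\,b))\,U\,r)$ is expressible in PastCTL$_\pm$ but not in CTL; for every $p\in AP$, the formula $A F p$ is expressible in CTL but is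 not FO-expressible, and it is not expressible in PastCTL$_\pm$. -/

import Mathlib

namespace TreeLogic

universe u

/-! ### Trees -/

/-- A leafless, finitely branching, unordered rooted tree whose nodes carry labels in `2^AP`.
The order `≤` of the underlying rooted tree is the ancestor relation, `⊥` is the root, and `v ⋖ w`
says that `w` is an immediate successor of `v`. Every such tree is countable, so `Type` is large
enough for the nodes. -/
structure LTree (AP : Type u) where
  /-- the underlying rooted tree -/
  tree : RootedTree.{0}
  /-- every node has at least one successor -/
  leafless : ∀ v : tree, ∃ w : tree, v ⋖ w
  /-- every node has finitely many successors -/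
  finite_succ : ∀ v : tree, {w : tree | v ⋖ w}.Finite
  /-- the labelling of the nodes -/
  label : tree → Set AP

/-- The nodes of a labelled tree. -/
abbrev LTree.Node {AP : Type u} (t : LTree AP) : Type := t.tree

/-- Maximal paths. As the trees are leafless, these are exactly the infinite sequences of nodes in
which each node is followed by one of its successors. -/
def LTree.IsPath {AP : Type u} (t : LTree AP) (π : ℕ → t.Node) : Prop :=
  ∀ i, π i ⋖ π (i + 1)

/-! ### Full computation tree logic with past (graded) -/

mutual
/-- State formulae of PastCTL*. -/
inductive StateFormula (AP : Type u) : Type u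
  | atom : AP → StateFormula AP
  | neg : StateFormula AP → StateFormula AP
  | or : StateFormula AP → StateFormula AP → StateFormula AP
  /-- `D^n φ`: at least `n` successors satisfy `φ` -/
  | count : ℕ → StateFormula AP → StateFormula AP
  /-- the path quantifier `E` -/
  | E : PathFormula AP → StateFormula AP
/-- Path formulae of PastCTL*. -/
inductive PathFormula (AP : Type u) : Type u
  | state : StateFormula AP → PathFormula AP
  | neg : PathFormula AP → PathFormula AP
  | or : PathFormula AP → PathFormula AP → PathFormula AP
  /-- next -/
  | X : PathFormula AP → PathFormula AP
  /-- yesterday -/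
  | Y : PathFormula AP → PathFormula AP
  /-- until -/
  | U : PathFormula AP → PathFormula AP → PathFormula AP
  /-- release -/
  | R : PathFormula AP → PathFormula AP → PathFormula AP
  /-- since -/
  | S : PathFormula AP → PathFormula AP → PathFormula AP
end

variable {AP : Type u}

mutual
/-- Satisfaction of a state formula at a pointed tree `(t, u)`. The path quantifier is
history-preserving: it ranges over the infinite paths that start at the root and visit `u`. -/
def StateFormula.Sat (t : LTree AP) : StateFormula AP → t.Node → Prop
  | .atom p, u => p ∈ t.label u
  | .neg φ, u => ¬ φ.Sat t u
  | .or φ₁ φ₂, u => φ₁.Sat t u ∨ φ₂.Sat t u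
  | .count n φ, u => ∃ F : Finset t.Node, F.card = n ∧ ∀ v ∈ F, u ⋖ v ∧ φ.Sat t v
  | .E ψ, u => ∃ π : ℕ → t.Node, t.IsPath π ∧ π 0 = ⊥ ∧ ∃ i, π i = u ∧ ψ.Sat t π i
/-- Satisfaction of a path formula at a path-pointed tree `(t, π, i)`. -/
def PathFormula.Sat (t : LTree AP) : PathFormula AP → (ℕ → t.Node) → ℕ → Prop
  | .state φ, π, i => φ.Sat t (π i)
  | .neg ψ, π, i => ¬ ψ.Sat t π i
  | .or ψ₁ ψ₂, π, i => ψ₁.Sat t π i ∨ ψ₂.Sat t π i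
  | .X ψ, π, i => ψ.Sat t π (i + 1)
  | .Y ψ, π, i => 0 < i ∧ ψ.Sat t π (i - 1)
  | .U ψ₁ ψ₂, π, i => ∃ j, i ≤ j ∧ ψ₂.Sat t π j ∧ ∀ k, i ≤ k → k < j → ψ₁.Sat t π k
  | .R ψ₁ ψ₂, π, i => (∀ j, i ≤ j → ψ₂.Sat t π j) ∨
      ∃ j, i ≤ j ∧ (ψ₁.Sat t π j ∧ ψ₂.Sat t π j) ∧ ∀ k, i ≤ k → k < j → ψ₂.Sat t π k
  | .S ψ₁ ψ₂, π, i => ∃ j, j ≤ i ∧ ψ₂.Sat t π j ∧ ∀ k, j < k → k ≤ i → ψ₁.Sat t π k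
end

/-- `t` is a model of `φ`: the formula `φ` holds at the root of `t`. -/
def Models (t : LTree AP) (φ : StateFormula AP) : Prop := φ.Sat t ⊥

/-- Initial equivalence: `φ` and `φ'` have the same models. -/
def InitEquiv (φ φ' : StateFormula AP) : Prop := ∀ t : LTree AP, Models t φ ↔ Models t φ'

/-! ### Fragments -/

mutual
/-- No past operator occurs in the state formula. -/
def StateFormula.IsFuture : StateFormula AP → Prop
  | .atom _ => True
  | .neg φ => φ.IsFuture
  | .or φ₁ φ₂ => φ₁.IsFuture ∧ φ₂.IsFuture
  | .count _ φ => φ.IsFuture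
  | .E ψ => ψ.IsFuture
/-- No past operator occurs in the path formula. -/
def PathFormula.IsFuture : PathFormula AP → Prop
  | .state φ => φ.IsFuture
  | .neg ψ => ψ.IsFuture
  | .or ψ₁ ψ₂ => ψ₁.IsFuture ∧ ψ₂.IsFuture
  | .X ψ => ψ.IsFuture
  | .Y _ => False
  | .U ψ₁ ψ₂ => ψ₁.IsFuture ∧ ψ₂.IsFuture
  | .R ψ₁ ψ₂ => ψ₁.IsFuture ∧ ψ₂.IsFuture
  | .S _ _ => False
end

mutual
/-- Every future temporal operator in the state formula is immediately preceded by `E`. -/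
def StateFormula.FutureGuarded : StateFormula AP → Prop
  | .atom _ => True
  | .neg φ => φ.FutureGuarded
  | .or φ₁ φ₂ => φ₁.FutureGuarded ∧ φ₂.FutureGuarded
  | .count _ φ => φ.FutureGuarded
  | .E ψ => ψ.AfterE
/-- The condition on a path formula that stands immediately after `E`:
its outermost operator may be a future operator. -/
def PathFormula.AfterE : PathFormula AP → Prop
  | .state φ => φ.FutureGuarded
  | .neg ψ => ψ.FutureGuarded
  | .or ψ₁ ψ₂ => ψ₁.FutureGuarded ∧ ψ₂.FutureGuarded
  | .X ψ => ψ.FutureGuarded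
  | .Y ψ => ψ.FutureGuarded
  | .U ψ₁ ψ₂ => ψ₁.FutureGuarded ∧ ψ₂.FutureGuarded
  | .R ψ₁ ψ₂ => ψ₁.FutureGuarded ∧ ψ₂.FutureGuarded
  | .S ψ₁ ψ₂ => ψ₁.FutureGuarded ∧ ψ₂.FutureGuarded
/-- The condition on a path formula that does not stand immediately after `E`:
its outermost operator is not a future operator. -/
def PathFormula.FutureGuarded : PathFormula AP → Prop
  | .state φ => φ.FutureGuarded
  | .neg ψ => ψ.FutureGuarded
  | .or ψ₁ ψ₂ => ψ₁.FutureGuarded ∧ ψ₂.FutureGuarded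
  | .X _ => False
  | .Y ψ => ψ.FutureGuarded
  | .U _ _ => False
  | .R _ _ => False
  | .S ψ₁ ψ₂ => ψ₁.FutureGuarded ∧ ψ₂.FutureGuarded
end

/-- CTL* (future-only formulae). -/
def CTLStar (AP : Type u) : Set (StateFormula AP) := {φ | φ.IsFuture}

/-- PastCTL: every future temporal operator is immediately preceded by `E`. -/
def PastCTL (AP : Type u) : Set (StateFormula AP) := {φ | φ.FutureGuarded}

/-- CTL: the intersection of CTL* and PastCTL. -/
def CTL (AP : Type u) : Set (StateFormula AP) := CTLStar AP ∩ PastCTL AP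

/-- The grammar of polarised PastCTL:
`φ ::= p | ¬φ | φ ∨ φ | D^n φ | E X φ | E (φ U φ) | E Y φ | E (φ S φ)`. -/
inductive IsPolarised : StateFormula AP → Prop
  | atom (p : AP) : IsPolarised (.atom p)
  | neg {φ : StateFormula AP} : IsPolarised φ → IsPolarised (.neg φ)
  | or {φ₁ φ₂ : StateFormula AP} : IsPolarised φ₁ → IsPolarised φ₂ → IsPolarised (.or φ₁ φ₂)
  | count (n : ℕ) {φ : StateFormula AP} : IsPolarised φ → IsPolarised (.count n φ)
  | EX {φ : StateFormula AP} : IsPolarised φ → IsPolarised (.E (.X (.state φ)))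
  | EU {φ₁ φ₂ : StateFormula AP} : IsPolarised φ₁ → IsPolarised φ₂ →
      IsPolarised (.E (.U (.state φ₁) (.state φ₂)))
  | EY {φ : StateFormula AP} : IsPolarised φ → IsPolarised (.E (.Y (.state φ)))
  | ES {φ₁ φ₂ : StateFormula AP} : IsPolarised φ₁ → IsPolarised φ₂ →
      IsPolarised (.E (.S (.state φ₁) (.state φ₂)))

/-- PastCTL±. -/
def PastCTLpm (AP : Type u) : Set (StateFormula AP) := {φ | IsPolarised φ}

/-- CTL±: the fragment of PastCTL± without past operators. -/
def CTLpm (AP : Type u) : Set (StateFormula AP) := {φ | IsPolarised φ ∧ φ.IsFuture}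

/-! ### Comparing expressive power -/

/-- Some formula of the logic `L` is initially equivalent to `φ`. -/
def Expressible (L : Set (StateFormula AP)) (φ : StateFormula AP) : Prop :=
  ∃ φ' ∈ L, InitEquiv φ' φ

mutual
/-- Gödel number of a state formula, given a numbering `e` of the propositions. -/
def StateFormula.code (e : AP → ℕ) : StateFormula AP → ℕ
  | .atom p => Nat.pair 0 (e p)
  | .neg φ => Nat.pair 1 (φ.code e)
  | .or φ₁ φ₂ => Nat.pair 2 (Nat.pair (φ₁.code e) (φ₂.code e))
  | .count n φ => Nat.pair 3 (Nat.pair n (φ.code e))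
  | .E ψ => Nat.pair 4 (ψ.code e)
/-- Gödel number of a path formula. -/
def PathFormula.code (e : AP → ℕ) : PathFormula AP → ℕ
  | .state φ => Nat.pair 0 (φ.code e)
  | .neg ψ => Nat.pair 1 (ψ.code e)
  | .or ψ₁ ψ₂ => Nat.pair 2 (Nat.pair (ψ₁.code e) (ψ₂.code e))
  | .X ψ => Nat.pair 3 (ψ.code e)
  | .Y ψ => Nat.pair 4 (ψ.code e)
  | .U ψ₁ ψ₂ => Nat.pair 5 (Nat.pair (ψ₁.code e) (ψ₂.code e))
  | .R ψ₁ ψ₂ => Nat.pair 6 (Nat.pair (ψ₁.code e) (ψ₂.code e))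
  | .S ψ₁ ψ₂ => Nat.pair 7 (Nat.pair (ψ₁.code e) (ψ₂.code e))
end

/-- There is an effective (computable on Gödel numbers, for every injective numbering of the
propositions) translation of each formula of `L` to an initially equivalent formula of `L'`. -/
def EffectivelyTranslates (L L' : Set (StateFormula AP)) : Prop :=
  ∃ f : StateFormula AP → StateFormula AP,
    (∀ φ ∈ L, f φ ∈ L' ∧ InitEquiv (f φ) φ) ∧
    ∀ e : AP → ℕ, Function.Injective e →
      ∃ g : ℕ → ℕ, Computable g ∧ ∀ φ ∈ L, g (φ.code e) = (f φ).code e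

/-- `L` is strictly less expressive than `L'`: `L` translates effectively to `L'`, while some
formula of `L'` has no initially equivalent formula in `L` at all. -/
def StrictlyLessExpressive (L L' : Set (StateFormula AP)) : Prop :=
  EffectivelyTranslates L L' ∧ ∃ φ ∈ L', ¬ Expressible L φ

/-- Each of the two logics has a formula that is not expressible in the other one. -/
def Incomparable (L L' : Set (StateFormula AP)) : Prop :=
  (∃ φ ∈ L, ¬ Expressible L' φ) ∧ (∃ φ ∈ L', ¬ Expressible L φ)

/-! ### First-order logic over trees with the ancestor relation -/

/-- The relation symbols: the binary ancestor relation, and a unary predicate for each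
proposition. -/
inductive TreeRel (AP : Type u) : ℕ → Type u
  | pred : AP → TreeRel AP 1
  | le : TreeRel AP 2

/-- The first-order language of labelled trees. -/
def treeLang (AP : Type u) : FirstOrder.Language.{0, u} where
  Functions _ := Empty
  Relations := TreeRel AP

/-- A labelled tree as a first-order structure. -/
instance LTree.foStructure (t : LTree AP) : (treeLang AP).Structure t.Node where
  funMap f := Empty.elim f
  RelMap
    | .pred p, x => p ∈ t.label (x 0)
    | .le, x => x 0 ≤ x 1

/-- Some first-order sentence has the same models as `φ`. -/
def FOExpressible (φ : StateFormula AP) : Prop :=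
  ∃ χ : (treeLang AP).Sentence, ∀ t : LTree AP, t.Node ⊨ χ ↔ Models t φ

/-! ### The witnesses -/

/-- `E ((s ∨ (a U b)) U r)`. -/
def nestedUntil (s a b r : AP) : StateFormula AP :=
  .E (.U (.or (.state (.atom s)) (.U (.state (.atom a)) (.state (.atom b)))) (.state (.atom r)))

/-- `A F p = ¬ E ¬ (⊤ U p)`, with `⊤ = p ∨ ¬ p`. -/
def AF (p : AP) : StateFormula AP :=
  .neg (.E (.neg (.U (.or (.state (.atom p)) (.neg (.state (.atom p)))) (.state (.atom p)))))

end TreeLogic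

/-!
The inclusions hold by inspection of the grammars, so the effective translations are identities.

*`E ((s ∨ (a U b)) U r)` in polarised PastCTL.* Up to a node `v` labelled `r`, whether each node
before `v` satisfies `s ∨ (a U b)` can be found out by looking back from `v`, except for an
obligation `a U b` that is still pending at `v`; the latter is the state formula `E (a U b)` at `v`
(`forall_or_until_iff_pending`, `nestedUntilPolarised_initEquiv`).

*It is not expressible in CTL.* The states of a `Gadget` of kind `a` have three successors: a state
of kind `b` with the same flag, which meets the obligation `a U b`, and two states of kind `s`, one
for each flag, which violate it. After `n` rounds, only the flag `true` leads to `r`. Hence the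
formula holds for the flag `true` and fails for the flag `false`. A CTL formula of nesting depth at
most `k` cannot tell the flags apart before the last `k` rounds: a path that proceeds through the
`b`-successor can be imitated under the other flag by the `s`-successor with the original flag,
because a CTL modality only restricts the set of the states on the path
(`Gadget.stateInvariant_E_of_unfold`, `Gadget.exists_stateInvariant`). Counting modalities do not
help, as the successors under both flags match one by one.

*`A F p` is not first-order, nor in polarised PastCTL.* Both kinds of formulae are invariant under
Ehrenfeucht–Fraïssé games (`BoundedFormula.exists_EF_invariant`,
`IsPolarised.exists_EFInvariant`), so for each `M` it suffices to find two trees that the game of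
`M` rounds does not distinguish and that disagree on `A F p`. Let `cut n` be the binary tree in
which all propositions hold from depth `n` on. By finiteness of the number of types, `cut n` and
`cut (n + P)` are equivalent for some `n` and some `P > 0`. Now `cut (n + P)` is a context around a
copy of `cut n` at depth `P`; iterating the context infinitely often gives a tree `spine n P` with
an infinite path without `p`. This tree is still equivalent to `cut n` (`EF_spine_cut`), by the
compositionality of games (`EF.graft`) and the symmetry of `cut (n + P)`.
-/

namespace TreeLogic

universe u

variable {AP : Type u}

/-! ### Trees of words -/

/-- Finite words over `α`, ordered by the suffix relation. The head of the list is the most recent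
letter, so that the words `c :: x` are the immediate successors of `x`. -/
def Word (α : Type) : Type := List α

namespace Word

variable {α : Type}

/-- The immediate successor `c :: x` of `x`. -/
def cons (c : α) (x : Word α) : Word α := List.cons c x

/-- The longest common suffix. -/
def meet [DecidableEq α] : List α → List α → List α
  | [], _ => []
  | c :: x, y => if c :: x <:+ y then c :: x else meet x y

theorem meet_suffix_left [DecidableEq α] (x y : List α) : meet x y <:+ x := by
  induction x with
  | nil => simp [meet]
  | cons c x ih =>
    rw [meet]
    split_ifs
    · exact List.suffix_rfl
    · exact ih.trans (List.suffix_cons c x)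

theorem meet_suffix_right [DecidableEq α] (x y : List α) : meet x y <:+ y := by
  induction x with
  | nil => simp [meet]
  | cons c x ih =>
    rw [meet]
    split_ifs with h
    · exact h
    · exact ih

theorem suffix_meet [DecidableEq α] {z x y : List α} (hx : z <:+ x) (hy : z <:+ y) :
    z <:+ meet x y := by
  induction x with
  | nil => simpa [meet] using hx
  | cons c x ih =>
    rw [meet]
    split_ifs with h
    · exact hx
    · rcases List.suffix_cons_iff.1 hx with rfl | hx
      · exact absurd hy h
      · exact ih hx

instance [DecidableEq α] : SemilatticeInf (Word α) where
  le x y := List.IsSuffix (α := α) x y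
  le_refl _ := List.suffix_rfl
  le_trans _ _ _ := List.IsSuffix.trans
  le_antisymm _ _ h h' := h.eq_of_length (h.length_le.antisymm h'.length_le)
  inf := meet
  inf_le_left := meet_suffix_left
  inf_le_right := meet_suffix_right
  le_inf _ _ _ := suffix_meet

variable [DecidableEq α]

instance : OrderBot (Word α) where
  bot := ([] : List α)
  bot_le _ := List.nil_suffix

instance : PredOrder (Word α) where
  pred := List.tail (α := α)
  pred_le _ := List.tail_suffix _
  min_of_le_pred {a} h := by
    cases a with
    | nil => exact isMin_bot (α := Word α)
    | cons c x =>
      have h0 : (c :: x).length ≤ x.length := List.IsSuffix.length_le h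
      simp at h0
  le_pred_of_lt {a b} h := by
    cases b with
    | nil => exact absurd bot_le h.not_ge
    | cons c x =>
      rcases List.suffix_cons_iff.1 h.le with h' | h'
      · exact absurd h' h.ne
      · exact h'

instance : IsPredArchimedean (Word α) where
  exists_pred_iterate_of_le {a b} h := by
    induction b with
    | nil => exact ⟨0, le_antisymm bot_le h⟩
    | cons c x ih =>
      rcases List.suffix_cons_iff.1 h with h' | h'
      · exact ⟨0, h'.symm⟩
      · obtain ⟨n, hn⟩ := ih h'
        exact ⟨n + 1, hn⟩

theorem covBy_iff {x y : Word α} : x ⋖ y ↔ ∃ c : α, y = cons c x := by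
  constructor
  · intro h
    cases y with
    | nil => exact absurd bot_le h.lt.not_ge
    | cons c z =>
      have hz : Order.pred (cons c z : Word α) = x := h.pred_eq
      exact ⟨c, by rw [← hz]; rfl⟩
  · rintro ⟨c, rfl⟩
    have hle : x ≤ cons c x := List.suffix_cons c x
    have hne : x ≠ cons c x := fun h => List.cons_ne_self c x h.symm
    refine ⟨lt_of_le_of_ne hle hne, fun z hxz hz => ?_⟩
    rcases List.suffix_cons_iff.1 hz.le with h' | h'
    · exact hz.ne h'
    · exact hxz.not_ge h'

end Word

/-- The tree of all words over a finite alphabet, with the labelling `ℓ`. -/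
abbrev wordTree {α : Type} [DecidableEq α] [Finite α] [Nonempty α] (ℓ : Word α → Set AP) :
    LTree AP where
  tree := { α := Word α }
  leafless v := ⟨Word.cons (Classical.arbitrary α) v, Word.covBy_iff.2 ⟨_, rfl⟩⟩
  finite_succ v := by
    refine (Set.finite_range fun c : α => Word.cons c v).subset ?_
    intro w hw
    obtain ⟨c, rfl⟩ := Word.covBy_iff.1 hw
    exact ⟨c, rfl⟩
  label := ℓ

/-! ### Paths through a tree -/

namespace LTree

variable {t : LTree AP}

theorem IsPath.strictMono {π : ℕ → t.Node} (hπ : t.IsPath π) : StrictMono π :=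
  strictMono_nat_of_lt_succ fun i => (hπ i).lt

/-- A rooted path visits every ancestor of each of its nodes. -/
theorem IsPath.exists_eq_of_le {π : ℕ → t.Node} (hπ : t.IsPath π) (h0 : π 0 = ⊥) {i : ℕ}
    {v : t.Node} (hv : v ≤ π i) : ∃ j ≤ i, π j = v := by
  induction i with
  | zero => exact ⟨0, le_rfl, by rw [h0] at hv ⊢; exact (le_bot_iff.1 hv).symm⟩
  | succ i ih =>
    rcases hv.eq_or_lt with rfl | hv
    · exact ⟨i + 1, le_rfl, rfl⟩
    · have h := Order.le_pred_of_lt hv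
      rw [(hπ i).pred_eq] at h
      obtain ⟨j, hj, rfl⟩ := ih h
      exact ⟨j, by omega, rfl⟩

theorem exists_isPath_from (t : LTree AP) (v : t.Node) : ∃ π, t.IsPath π ∧ π 0 = v := by
  choose s hs using t.leafless
  refine ⟨fun n => s^[n] v, fun i => ?_, rfl⟩
  change s^[i] v ⋖ s^[i + 1] v
  rw [Function.iterate_succ_apply']
  exact hs _

/-- An initial segment of one path continued by another path. -/
theorem IsPath.glue {π ρ : ℕ → t.Node} (hπ : t.IsPath π) (hρ : t.IsPath ρ) {i : ℕ}
    (h : ρ 0 = π i) : t.IsPath fun j => if j ≤ i then π j else ρ (j - i) := by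
  intro j
  by_cases h1 : j + 1 ≤ i
  · simpa [h1, show j ≤ i by omega] using hπ j
  · by_cases h2 : j = i
    · subst h2
      simpa [← h] using hρ 0
    · have h3 : j + 1 - i = j - i + 1 := by omega
      simpa [h1, show ¬ j ≤ i by omega, h3] using hρ (j - i)

theorem exists_isPath_through (t : LTree AP) (v : t.Node) :
    ∃ π, t.IsPath π ∧ π 0 = ⊥ ∧ ∃ i, π i = v := by
  obtain ⟨n, hn⟩ := (bot_le (a := v)).exists_pred_iterate
  induction n generalizing v with
  | zero =>
    obtain ⟨π, hπ, h0⟩ := t.exists_isPath_from v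
    exact ⟨π, hπ, h0.trans hn, 0, h0⟩
  | succ n ih =>
    by_cases hv : IsMin v
    · obtain ⟨π, hπ, h0⟩ := t.exists_isPath_from v
      exact ⟨π, hπ, h0.trans (le_bot_iff.1 (hv bot_le)), 0, h0⟩
    · obtain ⟨π, hπ, h0, i, hi⟩ := ih (Order.pred v) hn
      obtain ⟨ρ, hρ, hρ0⟩ := t.exists_isPath_from v
      have hρ' : t.IsPath fun j => if j = 0 then π i else ρ (j - 1) := by
        rintro (_ | j)
        · simpa [hi, hρ0] using Order.pred_covBy_of_not_isMin hv
        · simpa using hρ j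
      refine ⟨_, hπ.glue hρ' (i := i) (by simp), by simpa using h0, i + 1, ?_⟩
      simpa using hρ0

/-- Every path from a node extends to a rooted path through this node. -/
theorem IsPath.exists_rooted {ρ : ℕ → t.Node} (hρ : t.IsPath ρ) :
    ∃ π, t.IsPath π ∧ π 0 = ⊥ ∧ ∃ i, ∀ j, π (i + j) = ρ j := by
  obtain ⟨π, hπ, h0, i, hi⟩ := t.exists_isPath_through (ρ 0)
  refine ⟨_, hπ.glue hρ hi.symm, by simpa using h0, i, fun j => ?_⟩
  rcases j with _ | j
  · simpa using hi
  · simp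

end LTree

/-! ### Node conditions for the polarised modalities -/

namespace StateFormula

variable {t : LTree AP} {u : t.Node} {φ φ₁ φ₂ : StateFormula AP}

theorem sat_atom {p : AP} : (StateFormula.atom p).Sat t u ↔ p ∈ t.label u := by
  rw [StateFormula.Sat]

theorem sat_neg : (StateFormula.neg φ).Sat t u ↔ ¬ φ.Sat t u := by
  rw [StateFormula.Sat]

theorem sat_or : (StateFormula.or φ₁ φ₂).Sat t u ↔ φ₁.Sat t u ∨ φ₂.Sat t u := by
  rw [StateFormula.Sat]

theorem sat_E {ψ : PathFormula AP} : (StateFormula.E ψ).Sat t u ↔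
    ∃ π : ℕ → t.Node, t.IsPath π ∧ π 0 = ⊥ ∧ ∃ i, π i = u ∧ ψ.Sat t π i := by
  rw [StateFormula.Sat]

theorem sat_count {n : ℕ} : (StateFormula.count n φ).Sat t u ↔
    ∃ F : Finset t.Node, F.card = n ∧ ∀ v ∈ F, u ⋖ v ∧ φ.Sat t v := by
  rw [StateFormula.Sat]

theorem sat_EX : (StateFormula.E (.X (.state φ))).Sat t u ↔ ∃ v, u ⋖ v ∧ φ.Sat t v := by
  simp only [sat_E, PathFormula.Sat]
  constructor
  · rintro ⟨π, hπ, -, i, rfl, h⟩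
    exact ⟨π (i + 1), hπ i, h⟩
  · rintro ⟨v, huv, hv⟩
    obtain ⟨π, hπ, h0, j, rfl⟩ := t.exists_isPath_through v
    rcases j with _ | j
    · exact absurd bot_le (h0 ▸ huv.lt).not_ge
    · refine ⟨π, hπ, h0, j, ?_, hv⟩
      rw [← huv.pred_eq, (hπ j).pred_eq]

theorem sat_EU : (StateFormula.E (.U (.state φ₁) (.state φ₂))).Sat t u ↔
    ∃ v, u ≤ v ∧ φ₂.Sat t v ∧ ∀ w, u ≤ w → w < v → φ₁.Sat t w := by
  simp only [sat_E, PathFormula.Sat]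
  constructor
  · rintro ⟨π, hπ, h0, i, rfl, j, hij, hj, h⟩
    refine ⟨π j, hπ.strictMono.monotone hij, hj, fun w hw hw' => ?_⟩
    obtain ⟨k, -, rfl⟩ := hπ.exists_eq_of_le h0 hw'.le
    exact h k (hπ.strictMono.le_iff_le.1 hw) (hπ.strictMono.lt_iff_lt.1 hw')
  · rintro ⟨v, huv, hv, h⟩
    obtain ⟨π, hπ, h0, j, rfl⟩ := t.exists_isPath_through v
    obtain ⟨i, hij, rfl⟩ := hπ.exists_eq_of_le h0 huv
    exact ⟨π, hπ, h0, i, rfl, j, hij, hv, fun k hk hk' =>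
      h _ (hπ.strictMono.monotone hk) (hπ.strictMono hk')⟩

theorem sat_EY : (StateFormula.E (.Y (.state φ))).Sat t u ↔ ∃ v, v ⋖ u ∧ φ.Sat t v := by
  simp only [sat_E, PathFormula.Sat]
  constructor
  · rintro ⟨π, hπ, -, i, rfl, hi, h⟩
    obtain ⟨i, rfl⟩ := Nat.exists_eq_succ_of_ne_zero hi.ne'
    exact ⟨π i, hπ i, h⟩
  · rintro ⟨v, hvu, hv⟩
    obtain ⟨π, hπ, h0, j, rfl⟩ := t.exists_isPath_through u
    rcases j with _ | j
    · exact absurd bot_le (h0 ▸ hvu.lt).not_ge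
    · refine ⟨π, hπ, h0, j + 1, rfl, j.succ_pos, ?_⟩
      rwa [Nat.add_sub_cancel, ← (hπ j).pred_eq, hvu.pred_eq]

theorem sat_ES : (StateFormula.E (.S (.state φ₁) (.state φ₂))).Sat t u ↔
    ∃ v, v ≤ u ∧ φ₂.Sat t v ∧ ∀ w, v < w → w ≤ u → φ₁.Sat t w := by
  simp only [sat_E, PathFormula.Sat]
  constructor
  · rintro ⟨π, hπ, h0, i, rfl, j, hij, hj, h⟩
    refine ⟨π j, hπ.strictMono.monotone hij, hj, fun w hw hw' => ?_⟩
    obtain ⟨k, hk, rfl⟩ := hπ.exists_eq_of_le h0 hw'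
    exact h k (hπ.strictMono.lt_iff_lt.1 hw) hk
  · rintro ⟨v, hvu, hv, h⟩
    obtain ⟨π, hπ, h0, i, rfl⟩ := t.exists_isPath_through u
    obtain ⟨j, hj, rfl⟩ := hπ.exists_eq_of_le h0 hvu
    exact ⟨π, hπ, h0, i, rfl, j, hj, hv, fun k hk hk' =>
      h _ (hπ.strictMono hk) (hπ.strictMono.monotone hk')⟩

end StateFormula

/-! ### Inclusions between the fragments -/

theorem InitEquiv.trans {φ φ' φ'' : StateFormula AP} (h : InitEquiv φ φ')
    (h' : InitEquiv φ' φ'') : InitEquiv φ φ'' :=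
  fun t => (h t).trans (h' t)

theorem Expressible.mono {L L' : Set (StateFormula AP)} (hL : L ⊆ L') {φ : StateFormula AP}
    (h : Expressible L φ) : Expressible L' φ :=
  let ⟨φ', hφ', h'⟩ := h
  ⟨φ', hL hφ', h'⟩

theorem Expressible.of_initEquiv {L : Set (StateFormula AP)} {φ φ' : StateFormula AP}
    (h : Expressible L φ) (h' : InitEquiv φ φ') : Expressible L φ' :=
  let ⟨χ, hχ, hχ'⟩ := h
  ⟨χ, hχ, hχ'.trans h'⟩

theorem EffectivelyTranslates.of_subset {L L' : Set (StateFormula AP)} (h : L ⊆ L') :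
    EffectivelyTranslates L L' :=
  ⟨id, fun _ hφ => ⟨h hφ, fun _ => Iff.rfl⟩, fun _ _ => ⟨id, Computable.id, fun _ _ => rfl⟩⟩

theorem IsPolarised.futureGuarded {φ : StateFormula AP} (h : IsPolarised φ) :
    φ.FutureGuarded := by
  induction h <;>
    simp_all [StateFormula.FutureGuarded, PathFormula.FutureGuarded, PathFormula.AfterE]

theorem CTLpm_subset_PastCTLpm : CTLpm AP ⊆ PastCTLpm AP := fun _ h => h.1

theorem PastCTLpm_subset_PastCTL : PastCTLpm AP ⊆ PastCTL AP := fun _ h => h.futureGuarded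

theorem CTLpm_subset_CTL : CTLpm AP ⊆ CTL AP := fun _ h => ⟨h.2, h.1.futureGuarded⟩

/-! ### The formula `E ((s ∨ (a U b)) U r)` in polarised PastCTL -/

namespace StateFormula

variable {t : LTree AP} {π : ℕ → t.Node}

theorem sat_EY_path (hπ : t.IsPath π) (h0 : π 0 = ⊥) {φ : StateFormula AP} {i : ℕ} :
    (StateFormula.E (.Y (.state φ))).Sat t (π i) ↔ 0 < i ∧ φ.Sat t (π (i - 1)) := by
  rw [sat_EY]
  rcases i with _ | i
  · simp only [h0, lt_irrefl, false_and, iff_false, not_exists, not_and]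
    exact fun v hv => absurd bot_le hv.lt.not_ge
  · constructor
    · rintro ⟨v, hv, h⟩
      rw [← hv.pred_eq, (hπ i).pred_eq] at h
      exact ⟨i.succ_pos, h⟩
    · exact fun h => ⟨π i, hπ i, h.2⟩

theorem sat_ES_path (hπ : t.IsPath π) (h0 : π 0 = ⊥) {φ₁ φ₂ : StateFormula AP} {i : ℕ} :
    (StateFormula.E (.S (.state φ₁) (.state φ₂))).Sat t (π i) ↔
      ∃ j ≤ i, φ₂.Sat t (π j) ∧ ∀ k, j < k → k ≤ i → φ₁.Sat t (π k) := by
  rw [sat_ES]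
  constructor
  · rintro ⟨v, hv, h, h'⟩
    obtain ⟨j, hj, rfl⟩ := hπ.exists_eq_of_le h0 hv
    exact ⟨j, hj, h, fun k hk hk' => h' _ (hπ.strictMono hk) (hπ.strictMono.monotone hk')⟩
  · rintro ⟨j, hj, h, h'⟩
    refine ⟨π j, hπ.strictMono.monotone hj, h, fun w hw hw' => ?_⟩
    obtain ⟨k, hk, rfl⟩ := hπ.exists_eq_of_le h0 hw'
    exact h' k (hπ.strictMono.lt_iff_lt.1 hw) hk

/-- Conjunction. -/
def and (φ₁ φ₂ : StateFormula AP) : StateFormula AP := .neg (.or (.neg φ₁) (.neg φ₂))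

theorem sat_and {u : t.Node} {φ₁ φ₂ : StateFormula AP} :
    (φ₁.and φ₂).Sat t u ↔ φ₁.Sat t u ∧ φ₂.Sat t u := by
  simp only [StateFormula.and, sat_neg, sat_or]
  tauto

/-- Truth, written with the proposition `p`. -/
def top (p : AP) : StateFormula AP := .or (.atom p) (.neg (.atom p))

theorem sat_top {u : t.Node} {p : AP} : (top p).Sat t u := by
  simp only [top, sat_neg, sat_or]
  exact em _

end StateFormula

theorem IsPolarised.and {φ₁ φ₂ : StateFormula AP} (h₁ : IsPolarised φ₁) (h₂ : IsPolarised φ₂) :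
    IsPolarised (φ₁.and φ₂) :=
  .neg (.or (.neg h₁) (.neg h₂))

theorem isPolarised_top (p : AP) : IsPolarised (StateFormula.top p) :=
  .or (.atom p) (.neg (.atom p))

/-- Up to position `j`, the condition `S ∨ (A U B)` can be checked by looking back: say that the
obligation `A U B` is pending at `m` if some earlier position violates `S` and no `B` has occurred
since. Then `A` has to hold wherever the obligation is pending, and `A U B` has to hold at `j` if
the obligation is still pending just before `j`. -/
theorem forall_or_until_iff_pending (S A B : ℕ → Prop) (j : ℕ) :
    (∀ k, k < j → S k ∨ ∃ m, k ≤ m ∧ B m ∧ ∀ l, k ≤ l → l < m → A l) ↔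
      (∀ m, m < j → (∃ l ≤ m, ¬ S l ∧ ∀ k, l ≤ k → k ≤ m → ¬ B k) → A m) ∧
      ((∃ m, j ≤ m ∧ B m ∧ ∀ l, j ≤ l → l < m → A l) ∨
        ¬ (0 < j ∧ ∃ l ≤ j - 1, ¬ S l ∧ ∀ k, l ≤ k → k ≤ j - 1 → ¬ B k)) := by
  constructor
  · intro h
    refine ⟨?_, ?_⟩
    · rintro m hm ⟨l, hl, hS, hB⟩
      obtain ⟨m', hm', hBm', hA⟩ := (h l (by omega)).resolve_left hS
      refine hA m hl ?_
      by_contra hlt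
      exact hB m' hm' (by omega) hBm'
    · refine or_iff_not_imp_right.2 fun hp => ?_
      obtain ⟨hj, l, hl, hS, hB⟩ := not_not.1 hp
      obtain ⟨m', hm', hBm', hA⟩ := (h l (by omega)).resolve_left hS
      refine ⟨m', ?_, hBm', fun k hk hk' => hA k (by omega) hk'⟩
      by_contra hlt
      exact hB m' hm' (by omega) hBm'
  · rintro ⟨hA, hj⟩ k hk
    refine or_iff_not_imp_left.2 fun hS => ?_
    by_cases hB : ∃ m, k ≤ m ∧ m < j ∧ B m
    · classical
      obtain ⟨h1, h2, h3⟩ := Nat.find_spec hB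
      refine ⟨Nat.find hB, h1, h3, fun l hl hl' =>
        hA l (by omega) ⟨k, hl, hS, fun i hi hi' hBi => ?_⟩⟩
      exact Nat.find_min hB (m := i) (by omega) ⟨hi, by omega, hBi⟩
    · have hB' : ∀ i, k ≤ i → i < j → ¬ B i := fun i hi hi' h => hB ⟨i, hi, hi', h⟩
      obtain ⟨m, hm, hBm, hAm⟩ := hj.resolve_right fun h =>
        h ⟨by omega, k, by omega, hS, fun i hi hi' => hB' i hi (by omega)⟩
      refine ⟨m, by omega, hBm, fun l hl hl' => ?_⟩
      by_cases hlj : l < j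
      · exact hA l hlj ⟨k, hl, hS, fun i hi hi' => hB' i hi (by omega)⟩
      · exact hAm l (by omega) hl'

/-- `E (¬b S (¬s ∧ ¬b))`: some earlier node violates `s`, and no `b` has occurred since. -/
def pending (s b : AP) : StateFormula AP :=
  .E (.S (.state (.neg (.atom b)))
    (.state (StateFormula.and (.neg (.atom s)) (.neg (.atom b)))))

/-- The polarised form of `E ((s ∨ (a U b)) U r)`. It asks for a node that satisfies `r` and from
which the obligations of the earlier nodes are checked by looking back. -/
def nestedUntilPolarised (s a b r : AP) : StateFormula AP :=
  .E (.U (.state (.top r)) (.state (StateFormula.and (.atom r) (StateFormula.and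
    (.neg (.E (.Y (.state (.E (.S (.state (.top r))
      (.state (StateFormula.and (.neg (.atom a)) (pending s b)))))))))
    (.or (.E (.U (.state (.atom a)) (.state (.atom b))))
      (.neg (.E (.Y (.state (pending s b))))))))))

theorem isPolarised_nestedUntilPolarised (s a b r : AP) :
    IsPolarised (nestedUntilPolarised s a b r) := by
  have hp : IsPolarised (pending s b) :=
    .ES (.neg (.atom b)) (.and (.neg (.atom s)) (.neg (.atom b)))
  exact .EU (isPolarised_top r) (.and (.atom r) (.and
    (.neg (.EY (.ES (isPolarised_top r) (.and (.neg (.atom a)) hp))))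
    (.or (.EU (.atom a) (.atom b)) (.neg (.EY hp)))))

theorem sat_pending_path {t : LTree AP} {π : ℕ → t.Node} (hπ : t.IsPath π) (h0 : π 0 = ⊥)
    {s b : AP} {i : ℕ} : (pending s b).Sat t (π i) ↔
      ∃ l ≤ i, ¬ s ∈ t.label (π l) ∧ ∀ k, l ≤ k → k ≤ i → ¬ b ∈ t.label (π k) := by
  rw [pending, StateFormula.sat_ES_path hπ h0]
  simp only [StateFormula.sat_and, StateFormula.sat_neg, StateFormula.sat_atom]
  refine exists_congr fun l => and_congr_right fun hl => ?_
  constructor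
  · rintro ⟨⟨h1, h2⟩, h3⟩
    refine ⟨h1, fun k hk hk' => ?_⟩
    rcases hk.eq_or_lt with rfl | hk
    · exact h2
    · exact h3 k hk hk'
  · exact fun ⟨h1, h2⟩ => ⟨⟨h1, h2 l le_rfl hl⟩, fun k hk => h2 k hk.le⟩

theorem nestedUntilPolarised_initEquiv (s a b r : AP) :
    InitEquiv (nestedUntilPolarised s a b r) (nestedUntil s a b r) := by
  intro t
  have key : ∀ (π : ℕ → t.Node) (_ : t.IsPath π) (_ : π 0 = ⊥) (j : ℕ),
      (∀ k, k < j → s ∈ t.label (π k) ∨ ∃ m, k ≤ m ∧ b ∈ t.label (π m) ∧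
        ∀ l, k ≤ l → l < m → a ∈ t.label (π l)) ↔
      ¬ (StateFormula.E (.Y (.state (.E (.S (.state (.top r))
        (.state (StateFormula.and (.neg (.atom a)) (pending s b)))))))).Sat t (π j) ∧
      ((∃ m, j ≤ m ∧ b ∈ t.label (π m) ∧ ∀ l, j ≤ l → l < m → a ∈ t.label (π l)) ∨
        ¬ (StateFormula.E (.Y (.state (pending s b)))).Sat t (π j)) := by
    intro π hπ h0 j
    rw [forall_or_until_iff_pending]
    simp only [StateFormula.sat_EY_path hπ h0, StateFormula.sat_ES_path hπ h0,
      sat_pending_path hπ h0, StateFormula.sat_and, StateFormula.sat_top, StateFormula.sat_neg,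
      StateFormula.sat_atom]
    refine and_congr_left fun _ => ⟨?_, ?_⟩
    · rintro h ⟨hj, i, hi, ⟨ha, hp⟩, -⟩
      exact ha (h i (by omega) hp)
    · intro h m hm hp
      by_contra ha
      exact h ⟨by omega, m, by omega, ⟨ha, hp⟩, fun _ _ _ => trivial⟩
  simp only [Models, nestedUntilPolarised, StateFormula.sat_EU, StateFormula.sat_top,
    StateFormula.sat_and, StateFormula.sat_or, nestedUntil]
  rw [StateFormula.sat_E]
  simp only [PathFormula.Sat, StateFormula.sat_atom]
  constructor
  · rintro ⟨v, -, ⟨hr, h1, h2⟩, -⟩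
    rcases h2 with ⟨w, hvw, hb, ha⟩ | h2
    · -- the path is chosen to witness `a U b` at `v`
      obtain ⟨π, hπ, h0, m, rfl⟩ := t.exists_isPath_through w
      obtain ⟨j, hj, rfl⟩ := hπ.exists_eq_of_le h0 hvw
      refine ⟨π, hπ, h0, 0, h0, j, j.zero_le, hr, fun k _ hk => ?_⟩
      refine (key π hπ h0 j).2 ⟨h1, .inl ⟨m, hj, hb, fun l hl hl' => ?_⟩⟩ k hk
      exact ha _ (hπ.strictMono.monotone hl) (hπ.strictMono hl')
    · obtain ⟨π, hπ, h0, j, rfl⟩ := t.exists_isPath_through v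
      exact ⟨π, hπ, h0, 0, h0, j, j.zero_le, hr, fun k _ hk =>
        (key π hπ h0 j).2 ⟨h1, .inr h2⟩ k hk⟩
  · rintro ⟨π, hπ, h0, i, hi, j, -, hr, h⟩
    obtain rfl : i = 0 := hπ.strictMono.injective (hi.trans h0.symm)
    obtain ⟨h1, h2⟩ := (key π hπ h0 j).1 fun k hk => h k k.zero_le hk
    refine ⟨π j, bot_le, ⟨hr, h1, h2.imp ?_ id⟩, fun _ _ _ => trivial⟩
    rintro ⟨m, hm, hb, ha⟩
    refine ⟨π m, hπ.strictMono.monotone hm, hb, fun w hw hw' => ?_⟩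
    obtain ⟨l, -, rfl⟩ := hπ.exists_eq_of_le h0 hw'.le
    exact ha l (hπ.strictMono.le_iff_le.1 hw) (hπ.strictMono.lt_iff_lt.1 hw')

theorem expressible_nestedUntil (s a b r : AP) :
    Expressible (PastCTLpm AP) (nestedUntil s a b r) :=
  ⟨_, isPolarised_nestedUntilPolarised s a b r, nestedUntilPolarised_initEquiv s a b r⟩

/-! ### The formula `A F p` in CTL -/

/-- `¬ E (⊥ R ¬p)`. -/
def AFRelease (p : AP) : StateFormula AP :=
  .neg (.E (.R (.state (.neg (.top p))) (.state (.neg (.atom p)))))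

theorem AFRelease_mem_CTL (p : AP) : AFRelease p ∈ CTL AP := by
  simp [CTL, CTLStar, PastCTL, AFRelease, StateFormula.top, StateFormula.IsFuture,
    PathFormula.IsFuture, StateFormula.FutureGuarded, PathFormula.AfterE,
    PathFormula.FutureGuarded]

theorem models_AF {t : LTree AP} {p : AP} : Models t (AF p) ↔
    ∀ π : ℕ → t.Node, t.IsPath π → π 0 = ⊥ → ∃ i, p ∈ t.label (π i) := by
  simp only [Models, AF, StateFormula.sat_neg, StateFormula.sat_E, PathFormula.Sat,
    StateFormula.sat_atom, not_exists, not_and]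
  constructor
  · intro h π hπ h0
    by_contra hc
    exact h π hπ h0 0 h0 fun j _ hj => absurd ⟨j, hj⟩ hc
  · intro h π hπ h0 i hi
    obtain rfl : i = 0 := hπ.strictMono.injective (hi.trans h0.symm)
    obtain ⟨j, hj⟩ := h π hπ h0
    exact fun hn => hn j j.zero_le hj fun _ _ _ => em _

theorem AFRelease_initEquiv (p : AP) : InitEquiv (AFRelease p) (AF p) := by
  intro t
  rw [models_AF]
  simp only [Models, AFRelease, StateFormula.sat_neg, StateFormula.sat_E, PathFormula.Sat,
    StateFormula.sat_top, StateFormula.sat_atom, not_true_eq_false, false_and, and_false,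
    exists_false, or_false, not_exists, not_and, not_forall, not_not]
  constructor
  · intro h π hπ h0
    obtain ⟨j, -, hj⟩ := h π hπ h0 0 h0
    exact ⟨j, hj⟩
  · intro h π hπ h0 i hi
    obtain rfl : i = 0 := hπ.strictMono.injective (hi.trans h0.symm)
    obtain ⟨j, hj⟩ := h π hπ h0
    exact ⟨j, j.zero_le, hj⟩

theorem expressible_AF (p : AP) : Expressible (CTL AP) (AF p) :=
  ⟨_, AFRelease_mem_CTL p, AFRelease_initEquiv p⟩

/-! ### Word trees generated by a finite-state process -/

/-- The state that is reached from `σ` by reading a word, when the letters act by `δ`. -/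
def run {S α : Type} (δ : S → α → S) (σ : S) : Word α → S
  | [] => σ
  | c :: x => δ (run δ σ x) c

theorem run_cons {S α : Type} (δ : S → α → S) (σ : S) (c : α) (x : Word α) :
    run δ σ (.cons c x) = δ (run δ σ x) c := rfl

/-! ### The gadgets that separate polarised PastCTL from CTL -/

/-- The three sorts of gadget states. -/
inductive Kind
  | a
  | b
  | s

/-- The states of the gadgets. From a state of kind `a`, a path has to take the letter `none`, which
leads to a state of kind `b`, in order to meet the obligation `a U b`; taking `some h` violates it
and leads to the state of kind `s` with flag `h`. The proposition `r` is reached by counting the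
rank down to `0` with the flag `true`. -/
structure Gadget where
  /-- the sort of the state -/
  kind : Kind
  /-- whether `r` can still be reached without violating an obligation -/
  flag : Bool
  /-- the number of remaining rounds -/
  rank : ℕ

namespace Gadget

/-- The transition function of the gadgets. -/
def step : Gadget → Option Bool → Gadget
  | ⟨.a, g, 0⟩, _ => ⟨.a, g, 0⟩
  | ⟨.a, g, n + 1⟩, none => ⟨.b, g, n⟩
  | ⟨.a, _, n + 1⟩, some h => ⟨.s, h, n⟩
  | ⟨.b, g, n⟩, _ => ⟨.s, g, n⟩
  | ⟨.s, g, n⟩, _ => ⟨.a, g, n⟩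

/-- The label of a gadget state. -/
def label (s a b r : AP) : Gadget → Set AP
  | ⟨.a, true, 0⟩ => {r}
  | ⟨.a, false, 0⟩ => ∅
  | ⟨.a, _, _ + 1⟩ => {a}
  | ⟨.b, _, _⟩ => {b}
  | ⟨.s, _, _⟩ => {s}

/-- The tree that is generated by the gadget state `σ`. -/
abbrev tree (s a b r : AP) (σ : Gadget) : LTree AP :=
  wordTree fun x => (run step σ x).label s a b r

/-- Similarity of gadget states up to `k` nested modalities: the flags of states of rank more than
`k` are not compared. -/
def Sim (k : ℕ) (σ τ : Gadget) : Prop :=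
  σ = τ ∨ σ.kind = τ.kind ∧ σ.rank = τ.rank ∧ k < σ.rank

theorem Sim.symm {k : ℕ} {σ τ : Gadget} (h : Sim k σ τ) : Sim k τ σ := by
  rcases h with rfl | ⟨h1, h2, h3⟩
  · exact .inl rfl
  · exact .inr ⟨h1.symm, h2.symm, h2 ▸ h3⟩

theorem Sim.mono {k l : ℕ} (hkl : k ≤ l) {σ τ : Gadget} (h : Sim l σ τ) : Sim k σ τ :=
  h.imp_right fun ⟨h1, h2, h3⟩ => ⟨h1, h2, by omega⟩

theorem Sim.label_eq {k : ℕ} {σ τ : Gadget} (h : Sim k σ τ) (s a b r : AP) :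
    σ.label s a b r = τ.label s a b r := by
  rcases h with rfl | ⟨h1, h2, h3⟩
  · rfl
  · obtain ⟨κ, g, n⟩ := σ
    obtain ⟨κ', g', n'⟩ := τ
    obtain rfl : κ = κ' := h1
    obtain rfl : n = n' := h2
    obtain _ | n := n
    · exact absurd h3 (Nat.not_lt_zero _)
    · cases κ <;> cases g <;> cases g' <;> rfl

theorem Sim.step {k : ℕ} {σ τ : Gadget} (h : Sim (k + 1) σ τ) (c : Option Bool) :
    Sim k (σ.step c) (τ.step c) := by
  rcases h with rfl | ⟨h1, h2, h3⟩
  · exact .inl rfl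
  · obtain ⟨κ, g, n⟩ := σ
    obtain ⟨κ', g', n'⟩ := τ
    obtain rfl : κ = κ' := h1
    obtain rfl : n = n' := h2
    obtain _ | n := n
    · exact absurd h3 (Nat.not_lt_zero _)
    · have h4 : k < n := by simpa using h3
      cases κ
      · cases c
        · exact .inr ⟨rfl, rfl, h4⟩
        · exact .inl rfl
      · exact .inr ⟨rfl, rfl, h4.trans n.lt_succ_self⟩
      · exact .inr ⟨rfl, rfl, h4.trans n.lt_succ_self⟩

variable {s a b r : AP}

theorem covBy_iff {σ : Gadget} {x y : (tree s a b r σ).Node} :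
    x ⋖ y ↔ ∃ c : Option Bool, y = Word.cons c x :=
  Word.covBy_iff

/-! ### Invariance of CTL formulae under similarity -/

/-- The truth of `φ` in gadget trees is invariant under `Sim k`. -/
def StateInvariant (s a b r : AP) (k : ℕ) (φ : StateFormula AP) : Prop :=
  ∀ (σ τ : Gadget) (x y : Word (Option Bool)), Sim k (run step σ x) (run step τ y) →
    (φ.Sat (tree s a b r σ) x ↔ φ.Sat (tree s a b r τ) y)

/-- The truth of `ψ` in gadget trees depends on the current node only, and is invariant under
`Sim k`. -/
def PathInvariant (s a b r : AP) (k : ℕ) (ψ : PathFormula AP) : Prop :=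
  ∀ (σ τ : Gadget) (π ρ : ℕ → Word (Option Bool)) (i j : ℕ),
    Sim k (run step σ (π i)) (run step τ (ρ j)) →
      (ψ.Sat (tree s a b r σ) π i ↔ ψ.Sat (tree s a b r τ) ρ j)

theorem StateInvariant.mono {k l : ℕ} (hkl : k ≤ l) {φ : StateFormula AP}
    (h : StateInvariant s a b r k φ) : StateInvariant s a b r l φ :=
  fun σ τ x y hs => h σ τ x y (hs.mono hkl)

theorem PathInvariant.mono {k l : ℕ} (hkl : k ≤ l) {ψ : PathFormula AP}
    (h : PathInvariant s a b r k ψ) : PathInvariant s a b r l ψ :=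
  fun σ τ π ρ i j hs => h σ τ π ρ i j (hs.mono hkl)

theorem StateInvariant.of_imp {k : ℕ} {φ : StateFormula AP}
    (h : ∀ (σ τ : Gadget) (x y : Word (Option Bool)), Sim k (run step σ x) (run step τ y) →
      φ.Sat (tree s a b r σ) x → φ.Sat (tree s a b r τ) y) : StateInvariant s a b r k φ :=
  fun σ τ x y hs => ⟨h σ τ x y hs, h τ σ y x hs.symm⟩

theorem PathInvariant.stateInvariant_E {k : ℕ} {ψ : PathFormula AP}
    (h : PathInvariant s a b r k ψ) : StateInvariant s a b r k (.E ψ) := by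
  refine .of_imp fun σ τ x y hs => ?_
  simp only [StateFormula.sat_E]
  rintro ⟨π, -, -, i, rfl, hi⟩
  obtain ⟨ρ, hρ, h0, j, hj⟩ := (tree s a b r τ).exists_isPath_through y
  exact ⟨ρ, hρ, h0, j, hj, (h σ τ π ρ i j (hj ▸ hs)).1 hi⟩

/-- A path formula whose truth depends on the current node only holds on one path through this node
iff it holds on some path through it. -/
theorem PathInvariant.sat_iff {k : ℕ} {ψ : PathFormula AP} (h : PathInvariant s a b r k ψ)
    {σ : Gadget} {π : ℕ → (tree s a b r σ).Node} (hπ : (tree s a b r σ).IsPath π)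
    (h0 : π 0 = ⊥) (i : ℕ) :
    ψ.Sat (tree s a b r σ) π i ↔ (StateFormula.E ψ).Sat (tree s a b r σ) (π i) := by
  rw [StateFormula.sat_E]
  constructor
  · exact fun hi => ⟨π, hπ, h0, i, rfl, hi⟩
  · rintro ⟨ρ, -, -, j, hj, hj'⟩
    exact (h σ σ ρ π j i (.inl (congrArg _ hj))).1 hj'

theorem StateInvariant.count {k : ℕ} {φ : StateFormula AP} (h : StateInvariant s a b r k φ)
    (n : ℕ) : StateInvariant s a b r (k + 1) (.count n φ) := by
  classical
  refine .of_imp fun σ τ x y hs => ?_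
  simp only [StateFormula.sat_count]
  rintro ⟨F, hF, hF'⟩
  let f : Word (Option Bool) → Word (Option Bool) := fun v =>
    match v with
    | [] => y
    | c :: _ => .cons c y
  refine ⟨F.image f, ?_, ?_⟩
  · rw [← hF]
    refine Finset.card_image_of_injOn fun v hv w hw hvw => ?_
    obtain ⟨c, rfl⟩ := covBy_iff.1 (hF' v hv).1
    obtain ⟨d, rfl⟩ := covBy_iff.1 (hF' w hw).1
    obtain rfl : c = d := (List.cons.inj hvw).1
    rfl
  · intro v' hv'
    obtain ⟨v, hv, rfl⟩ := Finset.mem_image.1 hv'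
    obtain ⟨hc, hv'⟩ := hF' v hv
    obtain ⟨c, rfl⟩ := covBy_iff.1 hc
    exact ⟨covBy_iff.2 ⟨c, rfl⟩, (h σ τ (.cons c x) (.cons c y) (hs.step c)).1 hv'⟩

theorem PathInvariant.next {k : ℕ} {ψ : PathFormula AP} (h : PathInvariant s a b r k ψ) :
    StateInvariant s a b r (k + 1) (.E (.X ψ)) := by
  refine .of_imp fun σ τ x y hs => ?_
  simp only [StateFormula.sat_E, PathFormula.Sat]
  rintro ⟨π, hπ, -, i, rfl, hi⟩
  obtain ⟨c, hc⟩ := covBy_iff.1 (hπ i)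
  obtain ⟨ρ, hρ, h0, j, hj⟩ := (tree s a b r τ).exists_isPath_through (Word.cons c y)
  rcases j with _ | j
  · exact absurd (hj.symm.trans h0) (List.cons_ne_nil c y)
  · refine ⟨ρ, hρ, h0, j, ?_, (h σ τ π ρ (i + 1) (j + 1) ?_).1 hi⟩
    · rw [← (hρ j).pred_eq, hj]
      rfl
    · rw [hc, hj]
      exact hs.step c

/-- Equal states generate the same sequences of states. -/
theorem exists_isPath_of_run_eq {σ τ : Gadget} {x y : Word (Option Bool)}
    (h : run step σ x = run step τ y) {π : ℕ → (tree s a b r σ).Node}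
    (hπ : (tree s a b r σ).IsPath π) {i : ℕ} (hi : π i = x) :
    ∃ ρ : ℕ → (tree s a b r τ).Node, (tree s a b r τ).IsPath ρ ∧ ρ 0 = ⊥ ∧ ∃ j, ρ j = y ∧
      ∀ l, run step σ (π (i + l)) = run step τ (ρ (j + l)) := by
  choose c hc using fun l => covBy_iff.1 (hπ (i + l))
  let ρ : ℕ → (tree s a b r τ).Node := fun l => Nat.rec y (fun l z => Word.cons (c l) z) l
  have hρ : (tree s a b r τ).IsPath ρ := fun l => covBy_iff.2 ⟨c l, rfl⟩
  obtain ⟨ρ', hρ', h0, j, hj⟩ := hρ.exists_rooted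
  refine ⟨ρ', hρ', h0, j, hj 0, fun l => ?_⟩
  rw [hj]
  induction l with
  | zero => rw [Nat.add_zero, hi, h]; rfl
  | succ l ih => rw [← Nat.add_assoc, hc, run_cons, ih]; rfl

/-- A path formula that is determined by its states from the current position on, and that unfolds
along the path to `B₂ ∨ (B₁ ∧ X ψ)`, loses one level of similarity. From a state of kind `a`, only
the transition of letter `none` depends on the flag; if the path goes on after it, then the state
that follows is also reached by a direct transition in the other tree. -/
theorem stateInvariant_E_of_unfold {k : ℕ} {ψ : PathFormula AP}
    {B₁ B₂ : Gadget → Word (Option Bool) → Prop}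
    (hB₁ : ∀ σ τ x y, Sim k (run step σ x) (run step τ y) → B₁ σ x → B₁ τ y)
    (hB₂ : ∀ σ τ x y, Sim k (run step σ x) (run step τ y) → B₂ σ x → B₂ τ y)
    (hψ : ∀ (σ : Gadget) (π : ℕ → (tree s a b r σ).Node), (tree s a b r σ).IsPath π → π 0 = ⊥ →
      ∀ i, ψ.Sat (tree s a b r σ) π i ↔
        B₂ σ (π i) ∨ (B₁ σ (π i) ∧ ψ.Sat (tree s a b r σ) π (i + 1)))
    (heq : ∀ (σ τ : Gadget) (π ρ : ℕ → Word (Option Bool)) (i j : ℕ),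
      (∀ l, run step σ (π (i + l)) = run step τ (ρ (j + l))) →
        ψ.Sat (tree s a b r σ) π i → ψ.Sat (tree s a b r τ) ρ j) :
    StateInvariant s a b r (k + 1) (.E ψ) := by
  have eqv : ∀ (σ τ : Gadget) (x y : Word (Option Bool)), run step σ x = run step τ y →
      (StateFormula.E ψ).Sat (tree s a b r σ) x → (StateFormula.E ψ).Sat (tree s a b r τ) y := by
    intro σ τ x y h
    simp only [StateFormula.sat_E]
    rintro ⟨π, hπ, -, i, hi, hi'⟩
    obtain ⟨ρ, hρ, h0, j, hj, hl⟩ := exists_isPath_of_run_eq h hπ hi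
    exact ⟨ρ, hρ, h0, j, hj, heq σ τ π ρ i j hl hi'⟩
  have unfold_iff : ∀ (σ : Gadget) (x : Word (Option Bool)),
      (StateFormula.E ψ).Sat (tree s a b r σ) x ↔
        B₂ σ x ∨ (B₁ σ x ∧ ∃ c, (StateFormula.E ψ).Sat (tree s a b r σ) (Word.cons c x)) := by
    intro σ x
    simp only [StateFormula.sat_E]
    constructor
    · rintro ⟨π, hπ, h0, i, rfl, hi⟩
      refine ((hψ σ π hπ h0 i).1 hi).imp_right fun ⟨h1, h2⟩ => ⟨h1, ?_⟩
      obtain ⟨c, hc⟩ := covBy_iff.1 (hπ i)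
      exact ⟨c, π, hπ, h0, i + 1, hc, h2⟩
    · rintro (h | ⟨h, c, π, hπ, h0, i, hi, hi'⟩)
      · obtain ⟨π, hπ, h0, i, rfl⟩ := (tree s a b r σ).exists_isPath_through x
        exact ⟨π, hπ, h0, i, rfl, (hψ σ π hπ h0 i).2 (.inl h)⟩
      · rcases i with _ | i
        · exact absurd (hi.symm.trans h0) (List.cons_ne_nil c x)
        · have hx : π i = x := by
            rw [← (hπ i).pred_eq, hi]
            rfl
          exact ⟨π, hπ, h0, i, hx, (hψ σ π hπ h0 i).2 (.inr ⟨hx ▸ h, hi'⟩)⟩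
  -- the three kinds of states in turn, each with equal ranks above `k + 1`
  have main_a : ∀ (σ τ : Gadget) (x y : Word (Option Bool)) (g g' : Bool) (n : ℕ), k < n →
      run step σ x = ⟨.a, g, n + 1⟩ → run step τ y = ⟨.a, g', n + 1⟩ →
      (StateFormula.E ψ).Sat (tree s a b r σ) x → (StateFormula.E ψ).Sat (tree s a b r τ) y := by
    intro σ τ x y g g' n hn hx hy h
    have hsim : Sim k (run step σ x) (run step τ y) := by
      rw [hx, hy]
      exact .inr ⟨rfl, rfl, hn.trans n.lt_succ_self⟩
    rw [unfold_iff] at h ⊢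
    refine h.imp (hB₂ _ _ _ _ hsim) fun ⟨h1, c, h2⟩ => ⟨hB₁ _ _ _ _ hsim h1, ?_⟩
    obtain _ | c := c
    · have hx' : run step σ (Word.cons none x) = ⟨.b, g, n⟩ := by rw [run_cons, hx]; rfl
      have hy' : run step τ (Word.cons none y) = ⟨.b, g', n⟩ := by rw [run_cons, hy]; rfl
      rcases (unfold_iff _ _).1 h2 with h2 | ⟨-, c, h2⟩
      · refine ⟨none, (unfold_iff _ _).2 (.inl (hB₂ _ _ _ _ ?_ h2))⟩
        rw [hx', hy']
        exact .inr ⟨rfl, rfl, hn⟩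
      · refine ⟨some g, eqv _ _ _ _ ?_ h2⟩
        rw [run_cons, hx', run_cons, hy]
        rfl
    · refine ⟨some c, eqv _ _ _ _ ?_ h2⟩
      rw [run_cons, hx, run_cons, hy]
      rfl
  have main_s : ∀ (σ τ : Gadget) (x y : Word (Option Bool)) (g g' : Bool) (n : ℕ), k < n →
      run step σ x = ⟨.s, g, n + 1⟩ → run step τ y = ⟨.s, g', n + 1⟩ →
      (StateFormula.E ψ).Sat (tree s a b r σ) x → (StateFormula.E ψ).Sat (tree s a b r τ) y := by
    intro σ τ x y g g' n hn hx hy h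
    have hsim : Sim k (run step σ x) (run step τ y) := by
      rw [hx, hy]
      exact .inr ⟨rfl, rfl, hn.trans n.lt_succ_self⟩
    rw [unfold_iff] at h ⊢
    refine h.imp (hB₂ _ _ _ _ hsim) fun ⟨h1, c, h2⟩ => ⟨hB₁ _ _ _ _ hsim h1, c, ?_⟩
    refine main_a _ _ _ _ g g' n hn ?_ ?_ h2
    · rw [run_cons, hx]; rfl
    · rw [run_cons, hy]; rfl
  have main_b : ∀ (σ τ : Gadget) (x y : Word (Option Bool)) (g g' : Bool) (n : ℕ), k < n →
      run step σ x = ⟨.b, g, n + 1⟩ → run step τ y = ⟨.b, g', n + 1⟩ →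
      (StateFormula.E ψ).Sat (tree s a b r σ) x → (StateFormula.E ψ).Sat (tree s a b r τ) y := by
    intro σ τ x y g g' n hn hx hy h
    have hsim : Sim k (run step σ x) (run step τ y) := by
      rw [hx, hy]
      exact .inr ⟨rfl, rfl, hn.trans n.lt_succ_self⟩
    rw [unfold_iff] at h ⊢
    refine h.imp (hB₂ _ _ _ _ hsim) fun ⟨h1, c, h2⟩ => ⟨hB₁ _ _ _ _ hsim h1, c, ?_⟩
    refine main_s _ _ _ _ g g' n hn ?_ ?_ h2
    · rw [run_cons, hx]; rfl
    · rw [run_cons, hy]; rfl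
  refine .of_imp fun σ τ x y hs => ?_
  rcases hs with hs | ⟨h1, h2, h3⟩
  · exact eqv σ τ x y hs
  · rcases hx : run step σ x with ⟨κ, g, n⟩
    rcases hy : run step τ y with ⟨κ', g', n'⟩
    rw [hx, hy] at h1 h2
    rw [hx] at h3
    obtain rfl : κ = κ' := h1
    obtain rfl : n = n' := h2
    obtain _ | n := n
    · exact absurd h3 (Nat.not_lt_zero _)
    · have hn : k < n := by simpa using h3
      cases κ
      · exact main_a σ τ x y g g' n hn hx hy
      · exact main_b σ τ x y g g' n hn hx hy
      · exact main_s σ τ x y g g' n hn hx hy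

theorem PathInvariant.until {k : ℕ} {ψ₁ ψ₂ : PathFormula AP} (h₁ : PathInvariant s a b r k ψ₁)
    (h₂ : PathInvariant s a b r k ψ₂) : StateInvariant s a b r (k + 1) (.E (.U ψ₁ ψ₂)) := by
  refine stateInvariant_E_of_unfold
    (fun σ τ x y hs => (h₁.stateInvariant_E σ τ x y hs).1)
    (fun σ τ x y hs => (h₂.stateInvariant_E σ τ x y hs).1) ?_ ?_
  · intro σ π hπ h0 i
    simp only [← h₁.sat_iff hπ h0, ← h₂.sat_iff hπ h0, PathFormula.Sat]
    constructor
    · rintro ⟨j, hij, hj, h⟩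
      rcases hij.eq_or_lt with rfl | hij
      · exact .inl hj
      · exact .inr ⟨h i le_rfl hij, j, hij, hj, fun l hl => h l (by omega)⟩
    · rintro (h | ⟨h, j, hij, hj, h'⟩)
      · exact ⟨i, le_rfl, h, fun l hl hl' => by omega⟩
      · refine ⟨j, by omega, hj, fun l hl hl' => ?_⟩
        rcases hl.eq_or_lt with rfl | hl
        · exact h
        · exact h' l hl hl'
  · intro σ τ π ρ i j hl
    simp only [PathFormula.Sat]
    rintro ⟨m, hm, h, h'⟩
    obtain ⟨m, rfl⟩ := Nat.exists_eq_add_of_le hm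
    refine ⟨j + m, by omega, (h₂ σ τ π ρ _ _ (.inl (hl m))).1 h, fun l hjl hlm => ?_⟩
    obtain ⟨l, rfl⟩ := Nat.exists_eq_add_of_le hjl
    exact (h₁ σ τ π ρ _ _ (.inl (hl l))).1 (h' _ (by omega) (by omega))

theorem PathInvariant.release {k : ℕ} {ψ₁ ψ₂ : PathFormula AP}
    (h₁ : PathInvariant s a b r k ψ₁) (h₂ : PathInvariant s a b r k ψ₂) :
    StateInvariant s a b r (k + 1) (.E (.R ψ₁ ψ₂)) := by
  have e₁ := fun σ τ x y hs => (h₁.stateInvariant_E σ τ x y hs).1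
  have e₂ := fun σ τ x y hs => (h₂.stateInvariant_E σ τ x y hs).1
  refine stateInvariant_E_of_unfold e₂
    (fun σ τ x y hs (h : (StateFormula.E ψ₁).Sat (tree s a b r σ) x ∧
      (StateFormula.E ψ₂).Sat (tree s a b r σ) x) =>
        (⟨e₁ σ τ x y hs h.1, e₂ σ τ x y hs h.2⟩ : (StateFormula.E ψ₁).Sat (tree s a b r τ) y ∧
          (StateFormula.E ψ₂).Sat (tree s a b r τ) y)) ?_ ?_
  · intro σ π hπ h0 i
    simp only [← h₁.sat_iff hπ h0, ← h₂.sat_iff hπ h0, PathFormula.Sat]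
    constructor
    · rintro (h | ⟨j, hij, hj, h⟩)
      · exact .inr ⟨h i le_rfl, .inl fun l hl => h l (by omega)⟩
      · rcases hij.eq_or_lt with rfl | hij
        · exact .inl hj
        · exact .inr ⟨h i le_rfl hij, .inr ⟨j, hij, hj, fun l hl => h l (by omega)⟩⟩
    · rintro (h | ⟨h, h' | ⟨j, hij, hj, h'⟩⟩)
      · exact .inr ⟨i, le_rfl, h, fun l hl hl' => by omega⟩
      · refine .inl fun l hl => ?_
        rcases hl.eq_or_lt with rfl | hl
        · exact h
        · exact h' l hl
      · refine .inr ⟨j, by omega, hj, fun l hl hl' => ?_⟩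
        rcases hl.eq_or_lt with rfl | hl
        · exact h
        · exact h' l hl hl'
  · intro σ τ π ρ i j hl
    simp only [PathFormula.Sat]
    have f₂ : ∀ l, ψ₂.Sat (tree s a b r σ) π (i + l) → ψ₂.Sat (tree s a b r τ) ρ (j + l) :=
      fun l => (h₂ σ τ π ρ _ _ (.inl (hl l))).1
    rintro (h | ⟨m, hm, ⟨h, h'⟩, h''⟩)
    · refine .inl fun l hjl => ?_
      obtain ⟨l, rfl⟩ := Nat.exists_eq_add_of_le hjl
      exact f₂ l (h _ (by omega))
    · obtain ⟨m, rfl⟩ := Nat.exists_eq_add_of_le hm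
      refine .inr ⟨j + m, by omega, ⟨(h₁ σ τ π ρ _ _ (.inl (hl m))).1 h, f₂ m h'⟩,
        fun l hjl hlm => ?_⟩
      obtain ⟨l, rfl⟩ := Nat.exists_eq_add_of_le hjl
      exact f₂ l (h'' _ (by omega) (by omega))

mutual

theorem exists_stateInvariant : ∀ φ : StateFormula AP, φ.IsFuture → φ.FutureGuarded →
    ∃ k, StateInvariant s a b r k φ
  | .atom p, _, _ => ⟨0, fun σ τ x y hs => by
      rw [StateFormula.sat_atom, StateFormula.sat_atom]
      exact Set.ext_iff.1 (hs.label_eq s a b r) p⟩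
  | .neg φ, hf, hg => by
      simp only [StateFormula.IsFuture, StateFormula.FutureGuarded] at hf hg
      obtain ⟨k, hk⟩ := exists_stateInvariant φ hf hg
      refine ⟨k, fun σ τ x y hs => ?_⟩
      rw [StateFormula.sat_neg, StateFormula.sat_neg, hk σ τ x y hs]
  | .or φ₁ φ₂, hf, hg => by
      simp only [StateFormula.IsFuture, StateFormula.FutureGuarded] at hf hg
      obtain ⟨k, hk⟩ := exists_stateInvariant φ₁ hf.1 hg.1
      obtain ⟨l, hl⟩ := exists_stateInvariant φ₂ hf.2 hg.2
      refine ⟨max k l, fun σ τ x y hs => ?_⟩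
      rw [StateFormula.sat_or, StateFormula.sat_or, hk.mono (le_max_left k l) σ τ x y hs,
        hl.mono (le_max_right k l) σ τ x y hs]
  | .count n φ, hf, hg => by
      simp only [StateFormula.IsFuture, StateFormula.FutureGuarded] at hf hg
      obtain ⟨k, hk⟩ := exists_stateInvariant φ hf hg
      exact ⟨k + 1, hk.count n⟩
  | .E ψ, hf, hg => by
      simp only [StateFormula.IsFuture, StateFormula.FutureGuarded] at hf hg
      exact (exists_pathInvariant ψ hf).2 hg

theorem exists_pathInvariant : ∀ ψ : PathFormula AP, ψ.IsFuture →
    (ψ.FutureGuarded → ∃ k, PathInvariant s a b r k ψ) ∧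
    (ψ.AfterE → ∃ k, StateInvariant s a b r k (.E ψ))
  | .state φ, hf => by
      simp only [PathFormula.IsFuture, PathFormula.FutureGuarded, PathFormula.AfterE] at hf ⊢
      have h : φ.FutureGuarded → ∃ k, PathInvariant s a b r k (.state φ) := fun hg => by
        obtain ⟨k, hk⟩ := exists_stateInvariant φ hf hg
        refine ⟨k, fun σ τ π ρ i j hs => ?_⟩
        simp only [PathFormula.Sat]
        exact hk σ τ (π i) (ρ j) hs
      exact ⟨h, fun hg => (h hg).imp fun _ hk => hk.stateInvariant_E⟩
  | .neg ψ, hf => by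
      simp only [PathFormula.IsFuture, PathFormula.FutureGuarded, PathFormula.AfterE] at hf ⊢
      have h : ψ.FutureGuarded → ∃ k, PathInvariant s a b r k (.neg ψ) := fun hg => by
        obtain ⟨k, hk⟩ := (exists_pathInvariant ψ hf).1 hg
        refine ⟨k, fun σ τ π ρ i j hs => ?_⟩
        simp only [PathFormula.Sat]
        exact not_congr (hk σ τ π ρ i j hs)
      exact ⟨h, fun hg => (h hg).imp fun _ hk => hk.stateInvariant_E⟩
  | .or ψ₁ ψ₂, hf => by
      simp only [PathFormula.IsFuture, PathFormula.FutureGuarded, PathFormula.AfterE] at hf ⊢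
      have h : ψ₁.FutureGuarded ∧ ψ₂.FutureGuarded →
          ∃ k, PathInvariant s a b r k (.or ψ₁ ψ₂) := fun hg => by
        obtain ⟨k, hk⟩ := (exists_pathInvariant ψ₁ hf.1).1 hg.1
        obtain ⟨l, hl⟩ := (exists_pathInvariant ψ₂ hf.2).1 hg.2
        refine ⟨max k l, fun σ τ π ρ i j hs => ?_⟩
        simp only [PathFormula.Sat]
        exact or_congr (hk.mono (le_max_left k l) σ τ π ρ i j hs)
          (hl.mono (le_max_right k l) σ τ π ρ i j hs)
      exact ⟨h, fun hg => (h hg).imp fun _ hk => hk.stateInvariant_E⟩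
  | .X ψ, hf => by
      simp only [PathFormula.IsFuture, PathFormula.FutureGuarded, PathFormula.AfterE] at hf ⊢
      refine ⟨False.elim, fun hg => ?_⟩
      obtain ⟨k, hk⟩ := (exists_pathInvariant ψ hf).1 hg
      exact ⟨k + 1, hk.next⟩
  | .Y ψ, hf => by simp only [PathFormula.IsFuture] at hf
  | .U ψ₁ ψ₂, hf => by
      simp only [PathFormula.IsFuture, PathFormula.FutureGuarded, PathFormula.AfterE] at hf ⊢
      refine ⟨False.elim, fun hg => ?_⟩
      obtain ⟨k, hk⟩ := (exists_pathInvariant ψ₁ hf.1).1 hg.1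
      obtain ⟨l, hl⟩ := (exists_pathInvariant ψ₂ hf.2).1 hg.2
      exact ⟨_, (hk.mono (le_max_left k l)).until (hl.mono (le_max_right k l))⟩
  | .R ψ₁ ψ₂, hf => by
      simp only [PathFormula.IsFuture, PathFormula.FutureGuarded, PathFormula.AfterE] at hf ⊢
      refine ⟨False.elim, fun hg => ?_⟩
      obtain ⟨k, hk⟩ := (exists_pathInvariant ψ₁ hf.1).1 hg.1
      obtain ⟨l, hl⟩ := (exists_pathInvariant ψ₂ hf.2).1 hg.2
      exact ⟨_, (hk.mono (le_max_left k l)).release (hl.mono (le_max_right k l))⟩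
  | .S ψ₁ ψ₂, hf => by simp only [PathFormula.IsFuture] at hf

end

/-! ### The gadgets disagree on `E ((s ∨ (a U b)) U r)` -/

theorem models_nestedUntil_iff {t : LTree AP} : Models t (nestedUntil s a b r) ↔
    ∃ π : ℕ → t.Node, t.IsPath π ∧ π 0 = ⊥ ∧ ∃ j, r ∈ t.label (π j) ∧
      ∀ k < j, s ∈ t.label (π k) ∨
        ∃ m, k ≤ m ∧ b ∈ t.label (π m) ∧ ∀ l, k ≤ l → l < m → a ∈ t.label (π l) := by
  simp only [Models, nestedUntil]
  rw [StateFormula.sat_E]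
  simp only [PathFormula.Sat, StateFormula.sat_atom]
  refine exists_congr fun π => and_congr_right fun hπ => and_congr_right fun h0 => ?_
  constructor
  · rintro ⟨i, hi, j, -, hr, h⟩
    obtain rfl : i = 0 := hπ.strictMono.injective (hi.trans h0.symm)
    exact ⟨j, hr, fun k => h k k.zero_le⟩
  · rintro ⟨j, hr, h⟩
    exact ⟨0, h0, j, j.zero_le, hr, fun k _ => h k⟩

/-- The path that always takes the letter `none` meets all obligations on its way to `r`. -/
theorem models_nestedUntil_true (n : ℕ) :
    Models (tree s a b r ⟨.a, true, n⟩) (nestedUntil s a b r) := by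
  let π : ℕ → (tree s a b r ⟨.a, true, n⟩).Node := fun i =>
    Nat.rec (⊥ : Word (Option Bool)) (fun _ z => Word.cons none z) i
  refine models_nestedUntil_iff.2 ⟨π, fun i => covBy_iff.2 ⟨none, rfl⟩, rfl, ?_⟩
  have key : ∀ (n : ℕ) (f : ℕ → Gadget), (∀ i, f (i + 1) = (f i).step none) → ∀ i,
      f i = ⟨.a, true, n⟩ → ∃ j, r ∈ (f j).label s a b r ∧ ∀ k, i ≤ k → k < j →
        s ∈ (f k).label s a b r ∨ ∃ m, k ≤ m ∧ b ∈ (f m).label s a b r ∧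
          ∀ l, k ≤ l → l < m → a ∈ (f l).label s a b r := by
    intro n f hf
    induction n with
    | zero =>
      intro i hi
      refine ⟨i, ?_, fun k _ _ => by omega⟩
      rw [hi]
      exact Set.mem_singleton r
    | succ n ih =>
      intro i hi
      have h1 : f (i + 1) = ⟨.b, true, n⟩ := by rw [hf, hi]; rfl
      have h2 : f (i + 2) = ⟨.s, true, n⟩ := by rw [hf, h1]; rfl
      have h3 : f (i + 3) = ⟨.a, true, n⟩ := by rw [hf, h2]; rfl
      have hb : b ∈ (f (i + 1)).label s a b r := by rw [h1]; exact Set.mem_singleton b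
      obtain ⟨j, hj, h⟩ := ih (i + 3) h3
      refine ⟨j, hj, fun k hk hk' => ?_⟩
      obtain rfl | rfl | rfl | hk3 : k = i ∨ k = i + 1 ∨ k = i + 2 ∨ i + 3 ≤ k := by omega
      · refine .inr ⟨k + 1, by omega, hb, fun l hl hl' => ?_⟩
        obtain rfl : l = k := by omega
        rw [hi]
        exact Set.mem_singleton a
      · exact .inr ⟨i + 1, le_rfl, hb, fun l _ _ => by omega⟩
      · left
        rw [h2]
        exact Set.mem_singleton s
      · exact h k hk3 hk'
  obtain ⟨j, hj, h⟩ := key n (fun i => run step _ (π i)) (fun _ => rfl) 0 rfl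
  exact ⟨j, hj, fun k => h k k.zero_le⟩

/-- A path that meets its obligations up to a node labelled `r` never leaves the flag `false`. -/
theorem not_models_nestedUntil_false (hnd : [s, a, b, r].Nodup) (n : ℕ) :
    ¬ Models (tree s a b r ⟨.a, false, n⟩) (nestedUntil s a b r) := by
  simp only [List.nodup_cons, List.mem_cons, List.not_mem_nil, or_false, not_or,
    not_false_eq_true, List.nodup_nil, and_true] at hnd
  obtain ⟨⟨hsa, hsb, hsr⟩, ⟨hab, har⟩, hbr⟩ := hnd
  rw [models_nestedUntil_iff]
  rintro ⟨π, hπ, h0, j, hr, h⟩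
  have hstep : ∀ i, ∃ c, run step ⟨.a, false, n⟩ (π (i + 1)) =
      (run step ⟨.a, false, n⟩ (π i)).step c := fun i => by
    obtain ⟨c, hc⟩ := covBy_iff.1 (hπ i)
    exact ⟨c, by rw [hc, run_cons]⟩
  have key : ∀ i ≤ j, (run step ⟨.a, false, n⟩ (π i)).flag = false := by
    intro i
    induction i with
    | zero => rw [h0]; exact fun _ => rfl
    | succ i ih =>
      intro hi
      have hflag := ih (by omega)
      have hob := h i (by omega)
      obtain ⟨c, hc⟩ := hstep i
      change s ∈ (run step _ (π i)).label s a b r ∨ ∃ m, i ≤ m ∧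
        b ∈ (run step _ (π m)).label s a b r ∧ ∀ l, i ≤ l → l < m →
          a ∈ (run step _ (π l)).label s a b r at hob
      rcases hσ : run step ⟨.a, false, n⟩ (π i) with ⟨κ, g, m⟩
      rw [hσ] at hflag hc hob
      obtain rfl : g = false := hflag
      rw [hc]
      rcases κ with _ | _ | _
      · rcases m with _ | m
        · rfl
        · rcases c with _ | c
          · rfl
          · -- the state after `i` has kind `s`, which breaks the obligation `a U b` of position `i`
            exfalso
            have hc' : (run step ⟨.a, false, n⟩ (π (i + 1))).label s a b r = {s} := by
              rw [hc]; rfl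
            rcases hob with hob | ⟨m', hm', hb, ha⟩
            · exact hsa hob
            · obtain rfl | rfl | hm'' : m' = i ∨ m' = i + 1 ∨ i + 1 < m' := by omega
              · rw [hσ] at hb
                exact hab hb.symm
              · rw [hc'] at hb
                exact hsb hb.symm
              · have := ha (i + 1) (by omega) hm''
                rw [hc'] at this
                exact hsa this.symm
      · rfl
      · rfl
  have hj := key j le_rfl
  change r ∈ (run step ⟨.a, false, n⟩ (π j)).label s a b r at hr
  rcases hσ : run step ⟨.a, false, n⟩ (π j) with ⟨κ, g, m⟩
  rw [hσ] at hj hr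
  obtain rfl : g = false := hj
  rcases κ with _ | _ | _
  · rcases m with _ | m
    · exact hr
    · exact har hr.symm
  · exact hbr hr.symm
  · exact hsr hr.symm

end Gadget

theorem not_expressible_nestedUntil {s a b r : AP} (hnd : [s, a, b, r].Nodup) :
    ¬ Expressible (CTL AP) (nestedUntil s a b r) := by
  rintro ⟨φ, ⟨hf, hg⟩, hφ⟩
  obtain ⟨k, hk⟩ := Gadget.exists_stateInvariant (s := s) (a := a) (b := b) (r := r) φ hf hg
  refine Gadget.not_models_nestedUntil_false hnd (k + 1) ((hφ _).1 ?_)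
  exact (hk ⟨.a, true, k + 1⟩ ⟨.a, false, k + 1⟩ ⊥ ⊥ (.inr ⟨rfl, rfl, k.lt_succ_self⟩)).1
    ((hφ _).2 (Gadget.models_nestedUntil_true (k + 1)))

/-! ### Ehrenfeucht–Fraïssé games -/

/-- Duplicator wins the `k`-round Ehrenfeucht–Fraïssé game on two labelled orders from the position
`L`. A position is the set of the pairs of elements that have been chosen. -/
def EF {A B : Type} [LE A] [LE B] (la : A → Set AP) (lb : B → Set AP) : ℕ → Set (A × B) → Prop
  | 0, L => ∀ p ∈ L, la p.1 = lb p.2 ∧ ∀ q ∈ L, p.1 ≤ q.1 ↔ p.2 ≤ q.2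
  | k + 1, L => (∀ x, ∃ y, EF la lb k (insert (x, y) L)) ∧ ∀ y, ∃ x, EF la lb k (insert (x, y) L)

namespace EF

section

variable {A B C : Type} [LE A] [LE B] [LE C]
  {la : A → Set AP} {lb : B → Set AP} {lc : C → Set AP}

theorem mono {k : ℕ} {L L' : Set (A × B)} (h : EF la lb k L) (hL : L' ⊆ L) : EF la lb k L' := by
  induction k generalizing L L' with
  | zero => exact fun p hp => ⟨(h p (hL hp)).1, fun q hq => (h p (hL hp)).2 q (hL hq)⟩
  | succ k ih =>
    exact ⟨fun x => (h.1 x).imp fun y hy => ih hy (Set.insert_subset_insert hL),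
      fun y => (h.2 y).imp fun x hx => ih hx (Set.insert_subset_insert hL)⟩

theorem of_le [Nonempty A] {k l : ℕ} (hkl : k ≤ l) {L : Set (A × B)} (h : EF la lb l L) :
    EF la lb k L := by
  induction hkl with
  | refl => exact h
  | step _ ih =>
    obtain ⟨y, hy⟩ := h.1 (Classical.arbitrary A)
    exact ih (hy.mono (Set.subset_insert _ _))

theorem symm {k : ℕ} {L : Set (A × B)} (h : EF la lb k L) :
    EF lb la k {p | (p.2, p.1) ∈ L} := by
  induction k generalizing L with
  | zero => exact fun p hp => ⟨(h _ hp).1.symm, fun q hq => ((h _ hp).2 _ hq).symm⟩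
  | succ k ih =>
    refine ⟨fun y => (h.2 y).imp fun x hx => (ih hx).mono ?_,
      fun x => (h.1 x).imp fun y hy => (ih hy).mono ?_⟩ <;>
    · rintro p (rfl | hp)
      · exact .inl rfl
      · exact .inr hp

theorem trans {k : ℕ} {L : Set (A × B)} {M : Set (B × C)} (h : EF la lb k L)
    (h' : EF lb lc k M) : EF la lc k {p | ∃ b, (p.1, b) ∈ L ∧ (b, p.2) ∈ M} := by
  induction k generalizing L M with
  | zero =>
    rintro p ⟨b, hb, hb'⟩
    refine ⟨(h _ hb).1.trans (h' _ hb').1, ?_⟩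
    rintro q ⟨c, hc, hc'⟩
    exact ((h _ hb).2 _ hc).trans ((h' _ hb').2 _ hc')
  | succ k ih =>
    have hsub : ∀ x y z, insert (x, z) {p : A × C | ∃ b, (p.1, b) ∈ L ∧ (b, p.2) ∈ M} ⊆
        {p | ∃ b, (p.1, b) ∈ insert (x, y) L ∧ (b, p.2) ∈ insert (y, z) M} := by
      rintro x y z p (rfl | ⟨b, hb, hb'⟩)
      · exact ⟨y, .inl rfl, .inl rfl⟩
      · exact ⟨b, .inr hb, .inr hb'⟩
    constructor
    · intro x
      obtain ⟨y, hy⟩ := h.1 x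
      obtain ⟨z, hz⟩ := h'.1 y
      exact ⟨z, (ih hy hz).mono (hsub x y z)⟩
    · intro z
      obtain ⟨y, hy⟩ := h'.2 z
      obtain ⟨x, hx⟩ := h.2 y
      exact ⟨x, (ih hx hy).mono (hsub x y z)⟩

theorem of_automorphism {f : A → A} (hf : Function.Surjective f)
    (hle : ∀ x y, f x ≤ f y ↔ x ≤ y) (hla : ∀ x, la (f x) = la x) (k : ℕ) :
    EF la la k {p | p.2 = f p.1} := by
  induction k with
  | zero =>
    rintro ⟨x, x'⟩ (rfl : x' = f x)
    refine ⟨(hla x).symm, ?_⟩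
    rintro ⟨y, y'⟩ (rfl : y' = f y)
    exact (hle x y).symm
  | succ k ih =>
    constructor
    · exact fun x => ⟨f x, ih.mono (Set.insert_subset rfl subset_rfl)⟩
    · intro y
      obtain ⟨x, rfl⟩ := hf y
      exact ⟨x, ih.mono (Set.insert_subset rfl subset_rfl)⟩

/-- Duplicator can answer all elements of a finite set, one per round. -/
theorem exists_answers {k : ℕ} (F : Finset A) {L : Set (A × B)} (h : EF la lb (F.card + k) L) :
    ∃ L', L ⊆ L' ∧ EF la lb k L' ∧ ∀ x ∈ F, ∃ y, (x, y) ∈ L' := by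
  classical
  induction F using Finset.induction_on generalizing L with
  | empty => exact ⟨L, subset_rfl, by simpa using h, by simp⟩
  | insert x F hx ih =>
    rw [Finset.card_insert_of_notMem hx, Nat.add_right_comm] at h
    obtain ⟨y, hy⟩ := h.1 x
    obtain ⟨L', hL, hL', hF⟩ := ih hy
    refine ⟨L', (Set.subset_insert _ _).trans hL, hL', fun z hz => ?_⟩
    rcases Finset.mem_insert.1 hz with rfl | hz
    · exact ⟨y, hL (.inl rfl)⟩
    · exact hF z hz

end

section

variable {A B : Type} [PartialOrder A] [PartialOrder B] [Nonempty A]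
  {la : A → Set AP} {lb : B → Set AP} {k : ℕ} {L : Set (A × B)} {x x' : A} {y y' : B}

theorem label_eq (h : EF la lb k L) (hx : (x, y) ∈ L) : la x = lb y :=
  (h.of_le k.zero_le _ hx).1

theorem le_iff (h : EF la lb k L) (hx : (x, y) ∈ L) (hx' : (x', y') ∈ L) : x ≤ x' ↔ y ≤ y' :=
  (h.of_le k.zero_le _ hx).2 _ hx'

theorem lt_iff (h : EF la lb k L) (hx : (x, y) ∈ L) (hx' : (x', y') ∈ L) : x < x' ↔ y < y' := by
  rw [lt_iff_le_not_ge, lt_iff_le_not_ge, h.le_iff hx hx', h.le_iff hx' hx]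

theorem eq_iff (h : EF la lb k L) (hx : (x, y) ∈ L) (hx' : (x', y') ∈ L) : x = x' ↔ y = y' := by
  rw [le_antisymm_iff, le_antisymm_iff, h.le_iff hx hx', h.le_iff hx' hx]

theorem covBy (h : EF la lb (k + 1) L) (hx : (x, y) ∈ L) (hx' : (x', y') ∈ L) (hc : x ⋖ x') :
    y ⋖ y' := by
  refine ⟨(h.lt_iff hx hx').1 hc.lt, fun w hw hw' => ?_⟩
  obtain ⟨v, hv⟩ := h.2 w
  exact hc.2 ((hv.lt_iff (.inr hx) (.inl rfl)).2 hw) ((hv.lt_iff (.inl rfl) (.inr hx')).2 hw')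

end

end EF

/-! ### Formulae that are invariant under games -/

theorem BoundedFormula.exists_EF_invariant {n : ℕ} (φ : (treeLang AP).BoundedFormula Empty n) :
    ∃ k, ∀ (t t' : LTree AP) (xs : Fin n → t.Node) (ys : Fin n → t'.Node) (L : Set _),
      EF t.label t'.label k L → (∀ i, (xs i, ys i) ∈ L) →
        (φ.Realize default xs ↔ φ.Realize default ys) := by
  have hterm : ∀ {n : ℕ} (s : (treeLang AP).Term (Empty ⊕ Fin n)),
      ∃ i, s = FirstOrder.Language.Term.var (.inr i) := by
    rintro n ((e | i) | f)
    · exact e.elim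
    · exact ⟨i, rfl⟩
    · exact Empty.elim f
  induction φ with
  | falsum => exact ⟨0, fun _ _ _ _ _ _ _ => Iff.rfl⟩
  | equal s₁ s₂ =>
    obtain ⟨i, rfl⟩ := hterm s₁
    obtain ⟨j, rfl⟩ := hterm s₂
    exact ⟨0, fun t t' xs ys L hL hxy => hL.eq_iff (hxy i) (hxy j)⟩
  | rel R ss =>
    choose i hi using fun j => hterm (ss j)
    obtain rfl : ss = fun j => FirstOrder.Language.Term.var (.inr (i j)) := funext hi
    refine ⟨0, fun t t' xs ys L hL hxy => ?_⟩
    cases R with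
    | pred p => exact Set.ext_iff.1 (hL.label_eq (hxy (i 0))) p
    | le => exact hL.le_iff (hxy (i 0)) (hxy (i 1))
  | imp φ₁ φ₂ ih₁ ih₂ =>
    obtain ⟨k, hk⟩ := ih₁
    obtain ⟨l, hl⟩ := ih₂
    refine ⟨max k l, fun t t' xs ys L hL hxy => ?_⟩
    exact imp_congr (hk t t' xs ys L (hL.of_le (le_max_left k l)) hxy)
      (hl t t' xs ys L (hL.of_le (le_max_right k l)) hxy)
  | all φ ih =>
    obtain ⟨k, hk⟩ := ih
    refine ⟨k + 1, fun t t' xs ys L hL hxy => ?_⟩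
    have hsnoc : ∀ x y i, ((Fin.snoc xs x : Fin _ → t.Node) i, (Fin.snoc ys y : Fin _ → t'.Node) i)
        ∈ insert (x, y) L := by
      intro x y i
      refine Fin.lastCases ?_ (fun i => ?_) i
      · simp
      · simpa using Or.inr (hxy i)
    simp only [FirstOrder.Language.BoundedFormula.realize_all]
    constructor
    · intro h y
      obtain ⟨x, hx⟩ := hL.2 y
      exact (hk t t' _ _ _ hx (hsnoc x y)).1 (h x)
    · intro h x
      obtain ⟨y, hy⟩ := hL.1 x
      exact (hk t t' _ _ _ hy (hsnoc x y)).2 (h y)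

/-- The truth of `φ` is preserved from the first to the second node of each pair in a position from
which Duplicator wins `k` rounds. -/
def EFInvariant (k : ℕ) (φ : StateFormula AP) : Prop :=
  ∀ (t t' : LTree AP) (u : t.Node) (u' : t'.Node) (L : Set (t.Node × t'.Node)),
    EF t.label t'.label k L → (u, u') ∈ L → φ.Sat t u → φ.Sat t' u'

theorem EFInvariant.mono {k l : ℕ} (hkl : k ≤ l) {φ : StateFormula AP} (h : EFInvariant k φ) :
    EFInvariant l φ :=
  fun t t' u u' L hL => h t t' u u' L (hL.of_le hkl)

theorem EFInvariant.sat_iff {k : ℕ} {φ : StateFormula AP} (h : EFInvariant k φ)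
    {t t' : LTree AP} {u : t.Node} {u' : t'.Node} {L : Set (t.Node × t'.Node)}
    (hL : EF t.label t'.label k L) (hu : (u, u') ∈ L) : φ.Sat t u ↔ φ.Sat t' u' :=
  ⟨h t t' u u' L hL hu, h t' t u' u _ hL.symm hu⟩

theorem EFInvariant.count {k : ℕ} {φ : StateFormula AP} (h : EFInvariant (k + 1) φ) (n : ℕ) :
    EFInvariant (n + (k + 1)) (.count n φ) := by
  classical
  intro t t' u u' L hL hu
  simp only [StateFormula.sat_count]
  rintro ⟨F, rfl, hF⟩
  obtain ⟨L', hLL', hL', hans⟩ := hL.exists_answers F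
  choose! f hf using hans
  refine ⟨F.image f, Finset.card_image_of_injOn fun x hx y hy hxy => ?_, fun v' hv' => ?_⟩
  · exact (hL'.eq_iff (hf x hx) (hf y hy)).2 hxy
  · obtain ⟨v, hv, rfl⟩ := Finset.mem_image.1 hv'
    exact ⟨hL'.covBy (hLL' hu) (hf v hv) (hF v hv).1, h t t' _ _ L' hL' (hf v hv) (hF v hv).2⟩

/-- Every polarised formula, like a first-order formula, is invariant under a game of some length:
all its modalities quantify over nodes only. -/
theorem IsPolarised.exists_EFInvariant {φ : StateFormula AP} (hφ : IsPolarised φ) :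
    ∃ k, EFInvariant k φ := by
  induction hφ with
  | atom p =>
    refine ⟨0, fun t t' u u' L hL hu => ?_⟩
    rw [StateFormula.sat_atom, StateFormula.sat_atom]
    exact (Set.ext_iff.1 (hL.label_eq hu) p).1
  | neg _ ih =>
    obtain ⟨k, hk⟩ := ih
    refine ⟨k, fun t t' u u' L hL hu => ?_⟩
    rw [StateFormula.sat_neg, StateFormula.sat_neg]
    exact mt (hk.sat_iff hL hu).2
  | or _ _ ih₁ ih₂ =>
    obtain ⟨k, hk⟩ := ih₁
    obtain ⟨l, hl⟩ := ih₂
    refine ⟨max k l, fun t t' u u' L hL hu => ?_⟩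
    rw [StateFormula.sat_or, StateFormula.sat_or]
    exact Or.imp (hk.mono (le_max_left k l) t t' u u' L hL hu)
      (hl.mono (le_max_right k l) t t' u u' L hL hu)
  | count n _ ih =>
    obtain ⟨k, hk⟩ := ih
    exact ⟨_, (hk.mono k.le_succ).count n⟩
  | EX _ ih =>
    obtain ⟨k, hk⟩ := ih
    refine ⟨k + 1 + 1, fun t t' u u' L hL hu => ?_⟩
    simp only [StateFormula.sat_EX]
    rintro ⟨v, huv, hv⟩
    obtain ⟨v', hL'⟩ := hL.1 v
    exact ⟨v', hL'.covBy (.inr hu) (.inl rfl) huv,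
      hk.mono k.le_succ t t' v v' _ hL' (.inl rfl) hv⟩
  | EY _ ih =>
    obtain ⟨k, hk⟩ := ih
    refine ⟨k + 1 + 1, fun t t' u u' L hL hu => ?_⟩
    simp only [StateFormula.sat_EY]
    rintro ⟨v, huv, hv⟩
    obtain ⟨v', hL'⟩ := hL.1 v
    exact ⟨v', hL'.covBy (.inl rfl) (.inr hu) huv,
      hk.mono k.le_succ t t' v v' _ hL' (.inl rfl) hv⟩
  | EU _ _ ih₁ ih₂ =>
    obtain ⟨k, hk⟩ := ih₁
    obtain ⟨l, hl⟩ := ih₂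
    refine ⟨max k l + 1 + 1, fun t t' u u' L hL hu => ?_⟩
    simp only [StateFormula.sat_EU]
    rintro ⟨v, huv, hv, h⟩
    obtain ⟨v', hL'⟩ := hL.1 v
    refine ⟨v', (hL'.le_iff (.inr hu) (.inl rfl)).1 huv,
      hl.mono (by omega) t t' v v' _ hL' (.inl rfl) hv, fun w' huw hwv => ?_⟩
    obtain ⟨w, hL''⟩ := hL'.2 w'
    exact hk.mono (le_max_left k l) t t' w w' _ hL'' (.inl rfl)
      (h w ((hL''.le_iff (.inr (.inr hu)) (.inl rfl)).2 huw)
        ((hL''.lt_iff (.inl rfl) (.inr (.inl rfl))).2 hwv))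
  | ES _ _ ih₁ ih₂ =>
    obtain ⟨k, hk⟩ := ih₁
    obtain ⟨l, hl⟩ := ih₂
    refine ⟨max k l + 1 + 1, fun t t' u u' L hL hu => ?_⟩
    simp only [StateFormula.sat_ES]
    rintro ⟨v, hvu, hv, h⟩
    obtain ⟨v', hL'⟩ := hL.1 v
    refine ⟨v', (hL'.le_iff (.inl rfl) (.inr hu)).1 hvu,
      hl.mono (by omega) t t' v v' _ hL' (.inl rfl) hv, fun w' hvw hwu => ?_⟩
    obtain ⟨w, hL''⟩ := hL'.2 w'
    exact hk.mono (le_max_left k l) t t' w w' _ hL'' (.inl rfl)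
      (h w ((hL''.lt_iff (.inr (.inl rfl)) (.inl rfl)).2 hvw)
        ((hL''.le_iff (.inl rfl) (.inr (.inr hu))).2 hwu))

/-! ### Finitely many game types -/

/-- The types of rank `k` of `n`-tuples in labelled orders: a type of rank `0` records the order
and the labels, and a type of rank `k + 1` the set of the types of the one-point extensions. -/
def GameType (AP : Type u) : ℕ → ℕ → Type u
  | 0, n => (Fin n → Fin n → Prop) × (Fin n → Set AP)
  | k + 1, n => Set (GameType AP k (n + 1))

theorem GameType.finite [Finite AP] (k n : ℕ) : Finite (GameType AP k n) := by
  induction k generalizing n with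
  | zero => exact inferInstanceAs (Finite ((Fin n → Fin n → Prop) × (Fin n → Set AP)))
  | succ k ih =>
    have := ih (n + 1)
    exact inferInstanceAs (Finite (Set (GameType AP k (n + 1))))

/-- The type of rank `k` of the tuple `a`. -/
def gameType {A : Type} [LE A] (la : A → Set AP) : ∀ k n : ℕ, (Fin n → A) → GameType AP k n
  | 0, _, a => (fun i j => a i ≤ a j, fun i => la (a i))
  | k + 1, n, a => Set.range fun x => gameType la k (n + 1) (Fin.cons x a)

theorem EF.of_gameType_eq {A B : Type} [LE A] [LE B] {la : A → Set AP} {lb : B → Set AP}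
    {k n : ℕ} {a : Fin n → A} {b : Fin n → B} (h : gameType la k n a = gameType lb k n b) :
    EF la lb k (Set.range fun i => (a i, b i)) := by
  induction k generalizing n with
  | zero =>
    obtain ⟨h1, h2⟩ := Prod.ext_iff.1 h
    rintro _ ⟨i, rfl⟩
    refine ⟨congrFun h2 i, ?_⟩
    rintro _ ⟨j, rfl⟩
    exact iff_of_eq (congrFun (congrFun h1 i) j)
  | succ k ih =>
    have hsub : ∀ x y, insert (x, y) (Set.range fun i => (a i, b i)) ⊆
        Set.range fun i =>
          ((Fin.cons x a : Fin (n + 1) → A) i, (Fin.cons y b : Fin (n + 1) → B) i) := by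
      rintro x y _ (rfl | ⟨i, rfl⟩)
      · exact ⟨0, rfl⟩
      · exact ⟨i.succ, rfl⟩
    have h' : (Set.range fun x => gameType la k (n + 1) (Fin.cons x a)) =
      Set.range fun y => gameType lb k (n + 1) (Fin.cons y b) := h
    constructor
    · intro x
      obtain ⟨y, hy⟩ := (Set.ext_iff.1 h' _).1 ⟨x, rfl⟩
      exact ⟨y, (ih hy.symm).mono (hsub x y)⟩
    · intro y
      obtain ⟨x, hx⟩ := (Set.ext_iff.1 h' _).2 ⟨y, rfl⟩
      exact ⟨x, (ih hx).mono (hsub x y)⟩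

/-! ### Composition of games on word trees -/

namespace Word

variable {α : Type}

/-- The word that continues `q` by `y`. -/
def append (y q : Word α) : Word α := List.append y q

/-- The length of a word, which is the depth of the node. -/
def length (x : Word α) : ℕ := List.length x

theorem length_append (y q : Word α) : (append y q).length = y.length + q.length :=
  List.length_append (α := α)

theorem append_inj {x y q : Word α} : append x q = append y q ↔ x = y :=
  List.append_left_inj (α := α) q

variable [DecidableEq α]

theorem le_append (y q : Word α) : q ≤ append y q := List.suffix_append (α := α) y q

theorem append_le_append_iff {x y q : Word α} : append x q ≤ append y q ↔ x ≤ y :=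
  List.suffix_append_self_iff (α := α)

theorem exists_eq_append {q x : Word α} (h : q ≤ x) : ∃ y, x = append y q :=
  let ⟨y, hy⟩ := h
  ⟨y, hy.symm⟩

theorem le_total_of_le {x y z : Word α} (hx : x ≤ z) (hy : y ≤ z) : x ≤ y ∨ y ≤ x :=
  List.suffix_or_suffix_of_suffix hx hy

/-- The labelling `ℓ` with the subtree at `q` replaced by the labelling `m`. -/
def graft (q : Word α) (ℓ m : Word α → Set AP) : Word α → Set AP := fun x =>
  {p | (¬ q ≤ x ∧ p ∈ ℓ x) ∨ ∃ y, x = append y q ∧ p ∈ m y}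

theorem graft_of_not_le {q x : Word α} (hx : ¬ q ≤ x) (ℓ m : Word α → Set AP) :
    graft q ℓ m x = ℓ x := by
  ext p
  constructor
  · rintro (h | ⟨y, rfl, -⟩)
    · exact h.2
    · exact absurd (le_append y q) hx
  · exact fun h => .inl ⟨hx, h⟩

theorem graft_append (y q : Word α) (ℓ m : Word α → Set AP) : graft q ℓ m (append y q) = m y := by
  ext p
  constructor
  · rintro (h | ⟨z, hz, h⟩)
    · exact absurd (le_append y q) h.1
    · rwa [append_inj.1 hz]
  · exact fun h => .inr ⟨y, rfl, h⟩

theorem eq_graft {q : Word α} {ℓ m n : Word α → Set AP} (h : ∀ x, ¬ q ≤ x → n x = ℓ x)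
    (h' : ∀ y, n (append y q) = m y) : graft q ℓ m = n := by
  funext x
  by_cases hx : q ≤ x
  · obtain ⟨y, rfl⟩ := exists_eq_append hx
    rw [graft_append, h']
  · rw [graft_of_not_le hx, h x hx]

end Word

open Word

/-- Duplicator plays below `q` as in the game on the grafted labellings, and copies the moves of
Spoiler elsewhere. -/
theorem EF.graft {α : Type} [DecidableEq α] {m m' : Word α → Set AP} {k : ℕ}
    {L : Set (Word α × Word α)} (h : EF m m' k L) (q : Word α) (ℓ : Word α → Set AP) :
    EF (graft q ℓ m) (graft q ℓ m') k
      {p | (p.1 = p.2 ∧ ¬ q ≤ p.1) ∨ ∃ z ∈ L, p = (append z.1 q, append z.2 q)} := by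
  have aux : ∀ x y y' : Word α, ¬ q ≤ x → x ≤ append y q → x ≤ append y' q := fun x y y' hx hxy =>
    ((le_total_of_le hxy (le_append y q)).resolve_right hx).trans (le_append y' q)
  induction k generalizing L with
  | zero =>
    rintro ⟨x, x'⟩ (⟨rfl : x = x', hx⟩ | ⟨z, hz, hxz⟩)
    · refine ⟨by rw [graft_of_not_le hx, graft_of_not_le hx], ?_⟩
      rintro ⟨y, y'⟩ (⟨rfl : y = y', hy⟩ | ⟨w, hw, hyw⟩)
      · exact Iff.rfl
      · obtain ⟨rfl, rfl⟩ := Prod.mk.inj hyw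
        exact ⟨aux _ _ _ hx, aux _ _ _ hx⟩
    · obtain ⟨rfl, rfl⟩ := Prod.mk.inj hxz
      refine ⟨by rw [graft_append, graft_append]; exact (h z hz).1, ?_⟩
      rintro ⟨y, y'⟩ (⟨rfl : y = y', hy⟩ | ⟨w, hw, hyw⟩)
      · exact ⟨fun h' => absurd ((le_append _ _).trans h') hy,
          fun h' => absurd ((le_append _ _).trans h') hy⟩
      · obtain ⟨rfl, rfl⟩ := Prod.mk.inj hyw
        simp only [append_le_append_iff]
        exact (h z hz).2 w hw
  | succ k ih =>
    have hsub : ∀ y y', insert (append y q, append y' q)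
        {p : Word α × Word α | (p.1 = p.2 ∧ ¬ q ≤ p.1) ∨
          ∃ z ∈ L, p = (append z.1 q, append z.2 q)} ⊆
        {p | (p.1 = p.2 ∧ ¬ q ≤ p.1) ∨
          ∃ z ∈ insert (y, y') L, p = (append z.1 q, append z.2 q)} := by
      rintro y y' p (rfl | hp | ⟨z, hz, rfl⟩)
      · exact .inr ⟨(y, y'), .inl rfl, rfl⟩
      · exact .inl hp
      · exact .inr ⟨z, .inr hz, rfl⟩
    have hcopy : ∀ x, ¬ q ≤ x → EF (Word.graft q ℓ m) (Word.graft q ℓ m') k (insert (x, x)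
        {p : Word α × Word α | (p.1 = p.2 ∧ ¬ q ≤ p.1) ∨
          ∃ z ∈ L, p = (append z.1 q, append z.2 q)}) := by
      intro x hx
      obtain ⟨y, hy⟩ := h.1 x
      refine (ih hy).mono ?_
      rintro p (rfl | hp | ⟨z, hz, rfl⟩)
      · exact .inl ⟨rfl, hx⟩
      · exact .inl hp
      · exact .inr ⟨z, .inr hz, rfl⟩
    constructor
    · intro x
      by_cases hx : q ≤ x
      · obtain ⟨y, rfl⟩ := exists_eq_append hx
        obtain ⟨y', hy'⟩ := h.1 y
        exact ⟨append y' q, (ih hy').mono (hsub y y')⟩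
      · exact ⟨x, hcopy x hx⟩
    · intro x
      by_cases hx : q ≤ x
      · obtain ⟨y', rfl⟩ := exists_eq_append hx
        obtain ⟨y, hy⟩ := h.2 y'
        exact ⟨append y q, (ih hy).mono (hsub y y')⟩
      · exact ⟨x, hcopy x hx⟩

/-- Iterated grafting at `q`: all the words that are too short to reach the innermost grafted
labelling may be assumed to be copied. -/
theorem EF.graft_iterate {α : Type} [DecidableEq α] {m m' : Word α → Set AP} {k : ℕ}
    (h : EF m m' k {(⊥, ⊥)}) {q : Word α} (hq : ¬ q ≤ ⊥) (ℓ : Word α → Set AP) (d : ℕ)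
    {x : Word α} (hx : x.length < d) :
    EF ((Word.graft q ℓ)^[d] m) ((Word.graft q ℓ)^[d] m') k {(x, x), (⊥, ⊥)} := by
  induction d generalizing x with
  | zero => exact absurd hx (Nat.not_lt_zero _)
  | succ d ih =>
    rw [Function.iterate_succ_apply', Function.iterate_succ_apply']
    by_cases hqx : q ≤ x
    · obtain ⟨y, rfl⟩ := exists_eq_append hqx
      have hlen := length_append y q
      have hpos : 0 < q.length := by
        cases q with
        | nil => exact absurd bot_le hq
        | cons c q => exact Nat.succ_pos _
      refine ((ih (x := y) (by omega)).graft q ℓ).mono ?_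
      rintro p (rfl | rfl)
      · exact .inr ⟨(y, y), .inl rfl, rfl⟩
      · exact .inl ⟨rfl, hq⟩
    · have h' : ∃ L, EF ((Word.graft q ℓ)^[d] m) ((Word.graft q ℓ)^[d] m') k L := by
        rcases d with _ | d
        · exact ⟨_, h⟩
        · exact ⟨_, ih (x := ⊥) d.succ_pos⟩
      obtain ⟨L, hL⟩ := h'
      refine (hL.graft q ℓ).mono ?_
      rintro p (rfl | rfl)
      · exact .inl ⟨rfl, hqx⟩
      · exact .inl ⟨rfl, hq⟩

/-! ### Two binary trees that no first-order sentence separates -/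

/-- The word of `d` letters `false`. -/
def falses (d : ℕ) : Word Bool := List.replicate d false

/-- The labelling of the binary tree in which exactly the nodes of depth at least `n` carry
propositions. -/
def cut (AP : Type u) (n : ℕ) : Word Bool → Set AP := fun x => {_p | n ≤ x.length}

/-- The labelling of the binary tree that arises from `cut AP (n + P)` by grafting it at the node
`falses P` into itself infinitely often: a node `append y (falses (d * P))`, where `y` is not below
`falses P`, is labelled like `y` in `cut AP (n + P)`. The path `falses 0, falses 1, …` carries no
propositions. -/
def spine (AP : Type u) (n P : ℕ) : Word Bool → Set AP := fun x =>
  {_p | ∃ y d, x = append y (falses (d * P)) ∧ ¬ falses P ≤ y ∧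
    n + P ≤ y.length}

theorem append_falses_add (y : Word Bool) (c d : ℕ) :
    append y (falses (c + d)) = append (append y (falses c)) (falses d) := by
  have h : List.replicate (c + d) false = List.replicate c false ++ List.replicate d false :=
    List.replicate_add ..
  exact (congrArg (List.append y) h).trans (List.append_assoc y _ _).symm

theorem append_falses_zero (y : Word Bool) : append y (falses 0) = y := List.append_nil y

theorem length_falses (d : ℕ) : (falses d).length = d := List.length_replicate

theorem eq_falses_of_append_eq {y z : Word Bool} {d : ℕ} (h : append y z = falses d) :
    y = falses y.length :=
  (List.append_eq_replicate_iff.1 h).2.1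

theorem not_falses_le_bot {P : ℕ} (hP : 0 < P) : ¬ falses P ≤ ⊥ := by
  obtain ⟨P, rfl⟩ := Nat.exists_eq_succ_of_ne_zero hP.ne'
  exact fun h => List.cons_ne_nil _ _ (le_bot_iff.1 h)

theorem graft_cut (n P : ℕ) : graft (falses P) (cut AP (n + P)) (cut AP n) = cut AP (n + P) := by
  refine eq_graft (fun _ _ => rfl) fun y => ?_
  have hlen : (append y (falses P)).length = y.length + P := by
    rw [length_append, length_falses]
  ext p
  change n + P ≤ (append y (falses P)).length ↔ n ≤ y.length
  omega

theorem graft_spine (n P : ℕ) :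
    graft (falses P) (cut AP (n + P)) (spine AP n P) = spine AP n P := by
  refine eq_graft (fun x hx => ?_) fun y => ?_
  · ext p
    constructor
    · rintro ⟨y, d, rfl, hy, hn⟩
      rcases d with _ | d
      · rw [Nat.zero_mul, append_falses_zero]
        exact hn
      · rw [Nat.succ_mul, append_falses_add] at hx
        exact absurd (le_append _ _) hx
    · intro h
      exact ⟨x, 0, by rw [Nat.zero_mul, append_falses_zero], hx, h⟩
  · ext p
    constructor
    · rintro ⟨z, d, hz, hz', hn⟩
      rcases d with _ | d
      · rw [Nat.zero_mul, append_falses_zero] at hz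
        exact absurd (hz ▸ le_append _ _) hz'
      · rw [Nat.succ_mul, append_falses_add, append_inj] at hz
        exact ⟨z, d, hz, hz', hn⟩
    · rintro ⟨z, d, rfl, hz, hn⟩
      exact ⟨z, d + 1, by rw [Nat.succ_mul, append_falses_add], hz, hn⟩

theorem falses_notMem_spine {n P : ℕ} (d : ℕ) (p : AP) : p ∉ spine AP n P (falses d) := by
  rintro ⟨y, e, hy, hy', hn⟩
  have h := append_falses_add ⊥ (y.length - P) P
  rw [Nat.sub_add_cancel (by omega)] at h
  have h' : y = append (append ⊥ (falses (y.length - P))) (falses P) :=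
    (eq_falses_of_append_eq hy.symm).trans h
  exact hy' (h' ▸ le_append _ _)

/-- The automorphism of the binary tree that exchanges the letters. -/
def flip (x : Word Bool) : Word Bool := List.map (!·) x

theorem length_flip (x : Word Bool) : (flip x).length = x.length := List.length_map _

theorem flip_flip (x : Word Bool) : flip (flip x) = x := by
  induction x with
  | nil => rfl
  | cons c x ih => exact congrArg₂ List.cons (Bool.not_not c) ih

theorem flip_le_flip {x y : Word Bool} (h : x ≤ y) : flip x ≤ flip y := List.IsSuffix.map _ h

theorem not_falses_le_flip {P : ℕ} (hP : 0 < P) {x : Word Bool} (h : falses P ≤ x) :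
    ¬ falses P ≤ flip x := by
  intro h'
  have h1 := flip_le_flip h'
  rw [flip_flip] at h1
  have hlen := (length_flip (falses P)).symm
  have h2 : falses P = flip (falses P) := by
    rcases le_total_of_le h h1 with h2 | h2
    · exact List.IsSuffix.eq_of_length h2 hlen
    · exact (List.IsSuffix.eq_of_length h2 hlen.symm).symm
  obtain ⟨P, rfl⟩ := Nat.exists_eq_succ_of_ne_zero hP.ne'
  exact absurd (List.cons.inj h2).1 (by decide)

/-- If the game of `M` rounds does not distinguish `cut AP n` from `cut AP (n + P)`, then it does
not distinguish `cut AP n` from `spine AP n P`. An element `x` of the second tree lies in one of the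
copies of the context of `falses P` in `cut AP (n + P)`, and `cut AP n` is equivalent to the result
of grafting it into any finite number of nested copies of this context. An element of the first tree
is answered in `cut AP (n + P)`, where by symmetry the answer can be chosen in the context. -/
theorem EF_spine_cut {n P M : ℕ} (hP : 0 < P)
    (h : EF (cut AP n) (cut AP (n + P)) M {(⊥, ⊥)}) :
    EF (spine AP n P) (cut AP n) M {(⊥, ⊥)} := by
  set q := falses P
  have hq : ¬ q ≤ ⊥ := not_falses_le_bot hP
  set G := graft q (cut AP (n + P))
  have hcut : G (cut AP n) = cut AP (n + P) := graft_cut n P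
  have hspine : ∀ d, G^[d] (spine AP n P) = spine AP n P :=
    fun d => Function.iterate_fixed (graft_spine n P) d
  have hiter : ∀ d, EF (G^[d] (cut AP n)) (cut AP n) M {(⊥, ⊥)} := by
    intro d
    induction d with
    | zero =>
      refine (h.trans h.symm).mono ?_
      rintro p rfl
      exact ⟨⊥, rfl, rfl⟩
    | succ d ih =>
      rw [Function.iterate_succ_apply']
      have h1 := (ih.graft q (cut AP (n + P))).trans (hcut ▸ h.symm)
      refine h1.mono ?_
      rintro p rfl
      exact ⟨⊥, .inl ⟨rfl, hq⟩, rfl⟩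
  have key : ∀ k ≤ M, EF (spine AP n P) (cut AP n) k {(⊥, ⊥)} := by
    intro k
    induction k with
    | zero =>
      rintro - p rfl
      refine ⟨?_, fun q hq => by rw [hq]⟩
      rw [← hspine 1]
      exact (graft_of_not_le hq _ _).trans (h.label_eq rfl).symm
    | succ k ih =>
      intro hk
      have hk' := ih (by omega)
      constructor
      · intro x
        have h1 := hk'.graft_iterate hq (cut AP (n + P)) (x.length + 1)
          (x := x) (Nat.lt_succ_self _)
        change EF (G^[_] _) (G^[_] _) k _ at h1
        rw [hspine] at h1
        obtain ⟨y, hy⟩ := ((hiter (x.length + 1)).of_le hk).1 x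
        refine ⟨y, (h1.trans hy).mono ?_⟩
        rintro p (rfl | rfl)
        · exact ⟨x, .inl rfl, .inl rfl⟩
        · exact ⟨⊥, .inr rfl, .inr rfl⟩
      · intro y
        obtain ⟨x, hx, hqx⟩ : ∃ x, EF (cut AP n) (cut AP (n + P)) k {(y, x), (⊥, ⊥)} ∧
            ¬ q ≤ x := by
          obtain ⟨x, hx⟩ := (h.of_le hk).1 y
          by_cases hqx : q ≤ x
          · have hflip : EF (cut AP (n + P)) (cut AP (n + P)) k {p | p.2 = flip p.1} := by
              refine EF.of_automorphism (fun x => ⟨flip x, flip_flip x⟩)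
                (fun x y => ⟨fun h => ?_, flip_le_flip⟩) (fun x => ?_) k
              · simpa only [flip_flip] using flip_le_flip h
              · ext p
                change n + P ≤ (flip x).length ↔ n + P ≤ x.length
                rw [length_flip]
            refine ⟨flip x, (hx.trans hflip).mono ?_, not_falses_le_flip hP hqx⟩
            rintro p (rfl | rfl)
            · exact ⟨x, .inl rfl, rfl⟩
            · exact ⟨⊥, .inr rfl, rfl⟩
          · exact ⟨x, hx, hqx⟩
        have h1 := hk'.graft q (cut AP (n + P))
        change EF (G _) (G _) k _ at h1
        rw [hcut, show G (spine AP n P) = spine AP n P from hspine 1] at h1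
        refine ⟨x, (h1.trans hx.symm).mono ?_⟩
        rintro p (rfl | rfl)
        · exact ⟨x, .inl ⟨rfl, hqx⟩, .inl rfl⟩
        · exact ⟨⊥, .inl ⟨rfl, hq⟩, .inr rfl⟩
  exact key M le_rfl

/-- There are trees that agree on all games of `M` rounds but not on `A F p`. As there are only
finitely many types, some trees `cut AP n` and `cut AP n'` have the same type. -/
theorem exists_EF_not_AF [Finite AP] (M : ℕ) (p : AP) :
    ∃ t t' : LTree AP, EF t.label t'.label M {(⊥, ⊥)} ∧ ¬ Models t (AF p) ∧ Models t' (AF p) := by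
  have := GameType.finite (AP := AP) M 1
  obtain ⟨n, P, hP, hn⟩ : ∃ n P, 0 < P ∧ EF (cut AP n) (cut AP (n + P)) M {(⊥, ⊥)} := by
    obtain ⟨n, n', hne, hnn'⟩ := Finite.exists_ne_map_eq_of_infinite
      fun n => gameType (cut AP n) M 1 fun _ => ⊥
    rcases hne.lt_or_gt with hlt | hlt
    · obtain ⟨P, rfl⟩ := Nat.exists_eq_add_of_lt hlt
      refine ⟨n, P + 1, P.succ_pos, (EF.of_gameType_eq hnn').mono ?_⟩
      rintro _ rfl
      exact ⟨0, rfl⟩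
    · obtain ⟨P, rfl⟩ := Nat.exists_eq_add_of_lt hlt
      refine ⟨n', P + 1, P.succ_pos, (EF.of_gameType_eq hnn'.symm).mono ?_⟩
      rintro _ rfl
      exact ⟨0, rfl⟩
  refine ⟨wordTree (spine AP n P), wordTree (cut AP n), EF_spine_cut hP hn, ?_, ?_⟩
  · rw [models_AF]
    intro h
    obtain ⟨i, hi⟩ := h falses (fun i => Word.covBy_iff.2 ⟨false, rfl⟩) rfl
    exact falses_notMem_spine i p hi
  · rw [models_AF]
    intro π hπ h0
    have hlen : ∀ i, (π i).length = i := by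
      intro i
      induction i with
      | zero => rw [h0]; rfl
      | succ i ih =>
        obtain ⟨c, hc⟩ := Word.covBy_iff.1 (hπ i)
        rw [hc]
        exact congrArg (· + 1) ih
    exact ⟨n, (hlen n).ge⟩

theorem not_FOExpressible_AF [Finite AP] (p : AP) : ¬ FOExpressible (AF p) := by
  rintro ⟨χ, hχ⟩
  obtain ⟨k, hk⟩ := BoundedFormula.exists_EF_invariant χ
  obtain ⟨t, t', h, ht, ht'⟩ := exists_EF_not_AF k p
  exact ht ((hχ t).1 ((hk t t' default default _ h fun i => i.elim0).2 ((hχ t').2 ht')))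

theorem not_expressible_AF [Finite AP] (p : AP) : ¬ Expressible (PastCTLpm AP) (AF p) := by
  rintro ⟨φ, hφ, hφ'⟩
  obtain ⟨k, hk⟩ := IsPolarised.exists_EFInvariant hφ
  obtain ⟨t, t', h, ht, ht'⟩ := exists_EF_not_AF k p
  exact ht ((hφ' t).1 ((hk.sat_iff h rfl).2 ((hφ' t').2 ht')))

end TreeLogic

theorem mainTheorem10 {AP : Type*} [Finite AP] :
    TreeLogic.CTLpm AP ⊆ TreeLogic.PastCTLpm AP ∧
    TreeLogic.PastCTLpm AP ⊆ TreeLogic.PastCTL AP ∧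
    (∀ s a b r : AP, [s, a, b, r].Nodup →
      TreeLogic.StrictlyLessExpressive (TreeLogic.CTLpm AP) (TreeLogic.PastCTLpm AP) ∧
      TreeLogic.Incomparable (TreeLogic.PastCTLpm AP) (TreeLogic.CTL AP) ∧
      TreeLogic.Expressible (TreeLogic.PastCTLpm AP) (TreeLogic.nestedUntil s a b r) ∧
      ¬ TreeLogic.Expressible (TreeLogic.CTL AP) (TreeLogic.nestedUntil s a b r)) ∧
    (∀ p : AP,
      TreeLogic.StrictlyLessExpressive (TreeLogic.PastCTLpm AP) (TreeLogic.PastCTL AP) ∧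
      TreeLogic.Expressible (TreeLogic.CTL AP) (TreeLogic.AF p) ∧
      ¬ TreeLogic.FOExpressible (TreeLogic.AF p) ∧
      ¬ TreeLogic.Expressible (TreeLogic.PastCTLpm AP) (TreeLogic.AF p)) := by
  open TreeLogic in
  have hAF : ∀ p : AP, ∃ φ ∈ CTL AP, ¬ Expressible (PastCTLpm AP) φ := fun p =>
    let ⟨φ, hφ, hφ'⟩ := expressible_AF p
    ⟨φ, hφ, fun h => not_expressible_AF p (h.of_initEquiv hφ')⟩
  refine ⟨CTLpm_subset_PastCTLpm, PastCTLpm_subset_PastCTL, fun s a b r hnd => ?_, fun p => ?_⟩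
  · obtain ⟨φ, hφ, hφ'⟩ : ∃ φ ∈ PastCTLpm AP, ¬ Expressible (CTL AP) φ :=
      let ⟨φ, hφ, hφ'⟩ := expressible_nestedUntil s a b r
      ⟨φ, hφ, fun h => not_expressible_nestedUntil hnd (h.of_initEquiv hφ')⟩
    exact ⟨⟨.of_subset CTLpm_subset_PastCTLpm, φ, hφ, fun h => hφ' (h.mono CTLpm_subset_CTL)⟩,
      ⟨⟨φ, hφ, hφ'⟩, hAF s⟩, expressible_nestedUntil s a b r, not_expressible_nestedUntil hnd⟩
  · obtain ⟨φ, hφ, hφ'⟩ := hAF p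
    exact ⟨⟨.of_subset PastCTLpm_subset_PastCTL, φ, hφ.2, hφ'⟩, expressible_AF p,
      not_FOExpressible_AF p, not_expressible_AF p⟩
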